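/- Let $M$ be a model of Quine's New Foundations (NF): extensionality together with comprehension for every stratifiable formula of the language of set theory. Let $\mathbf N$ be the category whose objects are the sets of $M$ and whose morphisms $A\to B$ are the functions from $A$ to $B$ whose graph is a set of $M$. Write $\langle x,y\rangle$ for Quine's type-level ordered pair, and let $T:\mathbf N\to\mathbf N$ be the functor with $TA=\{\{x\}\mid x\in A\}$ and $Tf:\{x\}\mapsto\{f(x)\}$; for an object $B$ it induces $T_B:\mathbf N/B\to\mathbf N/TB$, $(C,\rho)\mapsto(TC,T\rho)$. Then $\mathbf N$ has pullbacks, and for every morphism $f:A\to B$ of $\mathbf N$ there is a functor $\tilde\Pi_f:\mathbf N/A\to\mathbf N/TB$ with the following description. On an object $\gamma:D\to A$, $$\tilde\Pi_f(D,\gamma)=\bigl\{\langle g,\{b\}\rangle \;\big|\; b\in B,\ g:f^{-1}\{b\}\to D,\ \gamma\circ g=\mathrm{id}_{f^{-1}\{b\}}\bigr\},$$ where $g$ ranges over functions that are sets (as sets of type-level pairs), with structure map $\langle g,\{b\}\rangle\mapsto\{b\}$ to $TB$; and a morphism $h:(D,\gamma)\to(D',\gamma')$ of $\mathbf N/A$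 is sent to $\langle g,\{b\}\rangle\mapsto\langle h\circ g,\{b\}\rangle$. Moreover the pullback functor $f^*:\mathbf N/B\to\mathbf N/A$ is a left adjoint of $\tilde\Pi_f$ relative to $T_B$: there are bijections $$\mathrm{Hom}_{\mathbf N/A}\bigl(f^*(C,\rho),(D,\gamma)\bigr)\;\cong\;\mathrm{Hom}_{\mathbf N/TB}\bigl((TC,T\rho),\tilde\Pi_f(D,\gamma)\bigr),$$ natural in $(C,\rho)\in\mathbf N/B$ and in $(D,\gamma)\in\mathbf N/A$. -/

import Mathlib

universe u v₁ v₂ v₃ u₁ u₂ u₃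

open CategoryTheory CategoryTheory.Limits

/-! ## Relative adjunctions -/

/-- The data exhibiting `F : E ⥤ C` as a left adjoint of `G : C ⥤ D` relative to `J : E ⥤ D`:
bijections `Hom(F A, B) ≃ Hom(J A, G B)`, natural in `A` and in `B`. -/
structure RelativeAdjunction {E : Type u₁} [Category.{v₁} E] {C : Type u₂} [Category.{v₂} C]
    {D : Type u₃} [Category.{v₃} D] (J : E ⥤ D) (F : E ⥤ C) (G : C ⥤ D) where
  homEquiv : ∀ (A : E) (B : C), (F.obj A ⟶ B) ≃ (J.obj A ⟶ G.obj B)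
  homEquiv_naturality_left : ∀ {A A' : E} (k : A' ⟶ A) {B : C} (m : F.obj A ⟶ B),
    homEquiv A' B (F.map k ≫ m) = J.map k ≫ homEquiv A B m
  homEquiv_naturality_right : ∀ {A : E} {B B' : C} (m : F.obj A ⟶ B) (h : B ⟶ B'),
    homEquiv A B' (m ≫ h) = homEquiv A B m ≫ G.map h

namespace NF

/-! ## Models of Quine's New Foundations -/

/-- Formulas of the language of set theory, with variables named by natural numbers. -/
inductive Fml : Type
  | eq (i j : ℕ) : Fml
  | mem (i j : ℕ) : Fml
  | neg (φ : Fml) : Fml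
  | and (φ ψ : Fml) : Fml
  | all (i : ℕ) (φ : Fml) : Fml

/-- Satisfaction of a formula under an assignment of the variables. -/
def Fml.Sat {M : Type u} [Membership M M] : Fml → (ℕ → M) → Prop
  | .eq i j, v => v i = v j
  | .mem i j, v => v i ∈ v j
  | .neg φ, v => ¬ φ.Sat v
  | .and φ ψ, v => φ.Sat v ∧ ψ.Sat v
  | .all i φ, v => ∀ x : M, φ.Sat (Function.update v i x)

/-- `σ` is a stratification of the formula. -/
def Fml.StratifiedBy (σ : ℕ → ℕ) : Fml → Prop
  | .eq i j => σ i = σ j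
  | .mem i j => σ i + 1 = σ j
  | .neg φ => φ.StratifiedBy σ
  | .and φ ψ => φ.StratifiedBy σ ∧ ψ.StratifiedBy σ
  | .all _ φ => φ.StratifiedBy σ

/-- `M` is a model of NF: extensionality and comprehension for all stratifiable formulas
(`v` supplies the parameters, and the `i`-th variable ranges over the elements of the new set). -/
class Model (M : Type u) extends Membership M M where
  nonempty : Nonempty M
  ext : ∀ x y : M, (∀ z, z ∈ x ↔ z ∈ y) → x = y
  comprehension : ∀ (φ : Fml) (σ : ℕ → ℕ), φ.StratifiedBy σ → ∀ (v : ℕ → M) (i : ℕ),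
    ∃ y : M, ∀ z, z ∈ y ↔ φ.Sat (Function.update v i z)

/-! ## A toolkit for stratified comprehension -/

/-- A relation between the values of the variables is given by a formula stratified by `σ`. -/
def Definable {M : Type u} [Membership M M] (σ : ℕ → ℕ) (R : (ℕ → M) → Prop) : Prop :=
  ∃ φ : Fml, φ.StratifiedBy σ ∧ ∀ v, φ.Sat v ↔ R v

section Toolkit

variable {M : Type u} [Membership M M] {σ : ℕ → ℕ} {R S : (ℕ → M) → Prop}

theorem Definable.eq (i j : ℕ) (h : σ i = σ j) : Definable (M := M) σ (fun v => v i = v j) :=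
  ⟨.eq i j, h, fun _ => Iff.rfl⟩

theorem Definable.mem (i j : ℕ) (h : σ i + 1 = σ j) :
    Definable (M := M) σ (fun v => v i ∈ v j) :=
  ⟨.mem i j, h, fun _ => Iff.rfl⟩

theorem Definable.neg (hR : Definable σ R) : Definable σ (fun v => ¬ R v) := by
  obtain ⟨φ, h, e⟩ := hR
  exact ⟨.neg φ, h, fun v => not_congr (e v)⟩

theorem Definable.and (hR : Definable σ R) (hS : Definable σ S) :
    Definable σ (fun v => R v ∧ S v) := by
  obtain ⟨φ, h, e⟩ := hR
  obtain ⟨ψ, h', e'⟩ := hS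
  exact ⟨.and φ ψ, ⟨h, h'⟩, fun v => and_congr (e v) (e' v)⟩

theorem Definable.all (i : ℕ) (hR : Definable σ R) :
    Definable σ (fun v => ∀ x, R (Function.update v i x)) := by
  obtain ⟨φ, h, e⟩ := hR
  exact ⟨.all i φ, h, fun v => forall_congr' fun x => e _⟩

theorem Definable.congr (hR : Definable σ R) (h : ∀ v, R v ↔ S v) : Definable σ S := by
  obtain ⟨φ, hs, e⟩ := hR
  exact ⟨φ, hs, fun v => (e v).trans (h v)⟩

theorem Definable.or (hR : Definable σ R) (hS : Definable σ S) :
    Definable σ (fun v => R v ∨ S v) :=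
  (hR.neg.and hS.neg).neg.congr fun v => by tauto

theorem Definable.iff (hR : Definable σ R) (hS : Definable σ S) :
    Definable σ (fun v => (R v ↔ S v)) :=
  ((hR.and hS).or (hR.neg.and hS.neg)).congr fun v => by tauto

theorem Definable.ex (i : ℕ) (hR : Definable σ R) :
    Definable σ (fun v => ∃ x, R (Function.update v i x)) :=
  (Definable.all i hR.neg).neg.congr fun v => by simp

end Toolkit

section Sets

variable {M : Type u} [Model M]

theorem Definable.exists_set {σ : ℕ → ℕ} {R : (ℕ → M) → Prop} (hR : Definable σ R)
    (v : ℕ → M) (i : ℕ) : ∃ y : M, ∀ z, z ∈ y ↔ R (Function.update v i z) := by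
  obtain ⟨φ, h, e⟩ := hR
  obtain ⟨y, hy⟩ := Model.comprehension φ σ h v i
  exact ⟨y, fun z => (hy z).trans (e _)⟩

/-! ## Singletons and Kuratowski pairs -/

theorem exists_singleton (x : M) : ∃ s : M, ∀ z, z ∈ s ↔ z = x := by
  obtain ⟨s, hs⟩ := (Definable.eq (M := M) (σ := fun _ => 0) 0 1 rfl).exists_set (fun _ => x) 0
  exact ⟨s, fun _ => by simpa using hs _⟩

/-- The singleton `{x}`. -/
noncomputable def sing (x : M) : M := (exists_singleton x).choose

theorem mem_sing {x z : M} : z ∈ sing x ↔ z = x := (exists_singleton x).choose_spec z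

theorem sing_injective {x y : M} (h : sing x = sing y) : x = y := by
  have : x ∈ sing y := h ▸ mem_sing.2 rfl
  exact mem_sing.1 this

theorem eq_sing_iff {x s : M} : s = sing x ↔ ∀ z, z ∈ s ↔ z = x :=
  ⟨fun h z => h ▸ mem_sing, fun h => Model.ext _ _ fun z => (h z).trans mem_sing.symm⟩

/-- `p` is the Kuratowski pair `{{x}, {x, y}}`. -/
def IsKPair (x y p : M) : Prop :=
  ∀ w, w ∈ p ↔ (∀ t, t ∈ w ↔ t = x) ∨ (∀ t, t ∈ w ↔ t = x ∨ t = y)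

theorem exists_upair (x y : M) : ∃ s : M, ∀ z, z ∈ s ↔ z = x ∨ z = y := by
  obtain ⟨s, hs⟩ := ((Definable.eq (M := M) (σ := fun _ => 0) 0 1 rfl).or
    (Definable.eq 0 2 rfl)).exists_set (fun n => if n = 1 then x else y) 0
  exact ⟨s, fun z => by simpa using hs z⟩

theorem exists_kpair (x y : M) : ∃ p : M, IsKPair x y p := by
  obtain ⟨s, hs⟩ := exists_upair x y
  obtain ⟨p, hp⟩ := exists_upair (sing x) s
  refine ⟨p, fun w => (hp w).trans (or_congr eq_sing_iff ?_)⟩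
  exact ⟨fun h => h ▸ hs, fun h => Model.ext _ _ fun z => (h z).trans (hs z).symm⟩

theorem IsKPair.inj {x y x' y' p : M} (h : IsKPair x y p) (h' : IsKPair x' y' p) :
    x = x' ∧ y = y' := by
  have hx : x = x' := by
    have h1 : sing x ∈ p := (h _).2 (Or.inl fun _ => mem_sing)
    have h2 : x' ∈ sing x := by
      rcases (h' _).1 h1 with h3 | h3
      · exact (h3 _).2 rfl
      · exact (h3 _).2 (Or.inl rfl)
    exact (mem_sing.1 h2).symm
  subst hx
  refine ⟨rfl, ?_⟩
  obtain ⟨s, hs⟩ := exists_upair x y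
  obtain ⟨s', hs'⟩ := exists_upair x y'
  have a1 : y = x ∨ y = y' := by
    rcases (h' s).1 ((h s).2 (Or.inr hs)) with h3 | h3
    · exact Or.inl ((h3 y).1 ((hs y).2 (Or.inr rfl)))
    · exact (h3 y).1 ((hs y).2 (Or.inr rfl))
  have a2 : y' = x ∨ y' = y := by
    rcases (h s').1 ((h' s').2 (Or.inr hs')) with h3 | h3
    · exact Or.inl ((h3 y').1 ((hs' y').2 (Or.inr rfl)))
    · exact (h3 y').1 ((hs' y').2 (Or.inr rfl))
  rcases a1 with a1 | a1
  · rcases a2 with a2 | a2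
    · exact a1.trans a2.symm
    · exact a2.symm
  · exact a1

theorem IsKPair.unique {x y p q : M} (h : IsKPair x y p) (h' : IsKPair x y q) : p = q :=
  Model.ext _ _ fun w => (h w).trans (h' w).symm

theorem definable_kpair {σ : ℕ → ℕ} (i j k : ℕ) (hi : i < 20) (hj : j < 20) (hk : k < 20)
    (hij : σ i = σ j) (hik : σ i + 2 = σ k) (h20 : σ 20 = σ i) (h21 : σ 21 = σ i + 1) :
    Definable (M := M) σ (fun v => IsKPair (v i) (v j) (v k)) := by
  have key : Definable (M := M) σ _ := Definable.all 21 ((Definable.mem 21 k (by omega)).iff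
    ((Definable.all 20 ((Definable.mem 20 21 (by omega)).iff (Definable.eq 20 i (by omega)))).or
      (Definable.all 20 ((Definable.mem 20 21 (by omega)).iff
        ((Definable.eq 20 i (by omega)).or (Definable.eq 20 j (by omega)))))))
  refine key.congr fun v => ?_
  have e1 : i ≠ 20 := by omega
  have e2 : i ≠ 21 := by omega
  have e3 : j ≠ 20 := by omega
  have e4 : j ≠ 21 := by omega
  have e5 : k ≠ 21 := by omega
  simp [IsKPair, e1, e2, e3, e4, e5]

/-! ## Quine's type-level ordered pair -/

/-- `z` is the Frege numeral zero, `{∅}`. -/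
def IsZero (z : M) : Prop := ∀ x, x ∈ z ↔ ∀ y, y ∉ x

/-- `m` is the successor of `n`: `m = {u ∪ {y} | u ∈ n, y ∉ u}`. -/
def IsSucc (n m : M) : Prop :=
  ∀ x, x ∈ m ↔ ∃ u ∈ n, ∃ y, y ∉ u ∧ ∀ w, w ∈ x ↔ w ∈ u ∨ w = y

/-- `n` is a Frege natural number: it lies in every inductive set. -/
def IsNat (n : M) : Prop :=
  ∀ X : M, (∀ z, IsZero z → z ∈ X) → (∀ k ∈ X, ∀ m, IsSucc k m → m ∈ X) → n ∈ X

/-- `w` is `y + 1` if `y` is a natural number, and `w` is `y` otherwise. -/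
def IsIncr (y w : M) : Prop := (IsNat y ∧ IsSucc y w) ∨ (¬ IsNat y ∧ w = y)

/-- `u` is the set `{incr y | y ∈ x}`. -/
def IsPhi (x u : M) : Prop := ∀ w, w ∈ u ↔ ∃ y ∈ x, IsIncr y w

/-- `p` is the Quine pair `⟨a, b⟩ = {φ(x) | x ∈ a} ∪ {φ(y) ∪ {0} | y ∈ b}`. -/
def IsPair (a b p : M) : Prop :=
  ∀ w, w ∈ p ↔ (∃ x ∈ a, IsPhi x w) ∨
    (∃ y ∈ b, ∃ u, IsPhi y u ∧ ∀ t, t ∈ w ↔ t ∈ u ∨ IsZero t)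

end Sets

/-! ## The category of NF sets -/

/-- The objects of the category of NF sets are the elements of the model. -/
structure NFSet (M : Type u) where
  carrier : M

/-- The elements of an NF set. -/
abbrev NFSet.Elem {M : Type u} [Model M] (A : NFSet M) : Type u := {x : M // x ∈ A.carrier}

/-- A morphism `A ⟶ B` is a function from `A` to `B` whose graph is a set of the model. (Graphs
are taken here as sets of Kuratowski pairs; by stratified comprehension, whether the graph of a
function is a set does not depend on the implementation of ordered pairs.) -/
@[ext]
structure NFSet.Hom {M : Type u} [Model M] (A B : NFSet M) : Type u where
  toFun : A.Elem → B.Elem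
  graph : ∃ G : M, ∀ p, p ∈ G ↔ ∃ x : A.Elem, IsKPair x.1 (toFun x).1 p

section Cat

variable {M : Type u} [Model M]

theorem exists_id_graph (A : NFSet M) :
    ∃ G : M, ∀ p, p ∈ G ↔ ∃ x : A.Elem, IsKPair x.1 x.1 p := by
  let σ : ℕ → ℕ := fun n => if n = 0 then 2 else if n = 2 then 1 else if n = 21 then 1 else 0
  have h : Definable (M := M) σ _ := Definable.ex 1 ((Definable.mem 1 2 (by simp [σ])).and
    (definable_kpair 1 1 0 (by simp) (by simp) (by simp) (by simp [σ]) (by simp [σ])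
      (by simp [σ]) (by simp [σ])))
  obtain ⟨G, hG⟩ := h.exists_set (fun _ => A.carrier) 0
  refine ⟨G, fun p => (hG p).trans ?_⟩
  simp

theorem exists_comp_graph {A B C : NFSet M} (f : NFSet.Hom A B) (g : NFSet.Hom B C) :
    ∃ G : M, ∀ p, p ∈ G ↔ ∃ x : A.Elem, IsKPair x.1 (g.toFun (f.toFun x)).1 p := by
  obtain ⟨F, hF⟩ := f.graph
  obtain ⟨H, hH⟩ := g.graph
  -- variables: 0 the new pair, 1 2 3 the three elements, 4 5 the given pairs, 6 7 the graphs
  let σ : ℕ → ℕ := fun n => if n = 0 ∨ n = 4 ∨ n = 5 then 2 else if n = 6 ∨ n = 7 then 3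
    else if n = 21 then 1 else 0
  have h : Definable (M := M) σ _ := Definable.ex 1 (Definable.ex 2 (Definable.ex 3
    (Definable.ex 4 (Definable.ex 5
      (((Definable.mem 4 6 (by simp [σ])).and (Definable.mem 5 7 (by simp [σ]))).and
      ((definable_kpair 1 2 4 (by simp) (by simp) (by simp) (by simp [σ]) (by simp [σ])
        (by simp [σ]) (by simp [σ])).and
      ((definable_kpair 2 3 5 (by simp) (by simp) (by simp) (by simp [σ]) (by simp [σ])
        (by simp [σ]) (by simp [σ])).and
      (definable_kpair 1 3 0 (by simp) (by simp) (by simp) (by simp [σ]) (by simp [σ])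
        (by simp [σ]) (by simp [σ])))))))))
  obtain ⟨G, hG⟩ := h.exists_set (fun n => if n = 6 then F else H) 0
  refine ⟨G, fun p => (hG p).trans ?_⟩
  simp only [Function.update_apply]
  constructor
  · rintro ⟨x, y, z, q, r, ⟨h1, h2⟩, h3, h4, h5⟩
    obtain ⟨a, ha⟩ := (hF q).1 (by simpa using h1)
    obtain ⟨b, hb⟩ := (hH r).1 (by simpa using h2)
    obtain ⟨rfl, rfl⟩ := IsKPair.inj ha (by simpa using h3)
    obtain ⟨e1, rfl⟩ := IsKPair.inj hb (by simpa using h4)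
    obtain rfl : b = f.toFun a := Subtype.ext e1
    exact ⟨a, by simpa using h5⟩
  · rintro ⟨a, ha⟩
    obtain ⟨q, hq⟩ := exists_kpair a.1 (f.toFun a).1
    obtain ⟨r, hr⟩ := exists_kpair (f.toFun a).1 (g.toFun (f.toFun a)).1
    exact ⟨a.1, (f.toFun a).1, (g.toFun (f.toFun a)).1, q, r,
      ⟨by simpa using (hF q).2 ⟨a, hq⟩, by simpa using (hH r).2 ⟨_, hr⟩⟩,
      by simpa using hq, by simpa using hr, by simpa using ha⟩

instance : Category (NFSet M) where
  Hom := NFSet.Hom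
  id A := ⟨id, exists_id_graph A⟩
  comp f g := ⟨fun x => g.toFun (f.toFun x), exists_comp_graph f g⟩

/-- The value of a morphism at an element. -/
def app {A B : NFSet M} (f : A ⟶ B) (x : A.Elem) : B.Elem := NFSet.Hom.toFun f x

theorem hom_ext {A B : NFSet M} {f g : A ⟶ B} (h : ∀ x, app f x = app g x) : f = g :=
  NFSet.Hom.ext (funext h)

@[simp] theorem app_id {A : NFSet M} (x : A.Elem) : app (𝟙 A) x = x := rfl

@[simp] theorem app_comp {A B C : NFSet M} (f : A ⟶ B) (g : B ⟶ C) (x : A.Elem) :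
    app (f ≫ g) x = app g (app f x) := rfl

/-! ## The functor `T` -/

theorem exists_usc (a : M) : ∃ s : M, ∀ z, z ∈ s ↔ ∃ x ∈ a, z = sing x := by
  let σ : ℕ → ℕ := fun n => if n = 0 ∨ n = 2 then 1 else 0
  have h : Definable (M := M) σ _ := Definable.ex 1 ((Definable.mem 1 2 (by simp [σ])).and
    (Definable.all 3 ((Definable.mem 3 0 (by simp [σ])).iff (Definable.eq 3 1 (by simp [σ])))))
  obtain ⟨s, hs⟩ := h.exists_set (fun _ => a) 0
  refine ⟨s, fun z => (hs z).trans ?_⟩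
  simp [eq_sing_iff]

/-- The set `{{x} | x ∈ a}` of singletons of elements of `a`. -/
noncomputable def usc (a : M) : M := (exists_usc a).choose

theorem mem_usc {a z : M} : z ∈ usc a ↔ ∃ x ∈ a, z = sing x := (exists_usc a).choose_spec z

/-- The element `{x}` of `T A`, for `x` an element of `A`. -/
noncomputable def singElem {A : NFSet M} (x : A.Elem) : NFSet.Elem ⟨usc A.carrier⟩ :=
  ⟨sing x.1, mem_usc.2 ⟨x.1, x.2, rfl⟩⟩

theorem exists_eq_singElem {A : NFSet M} (z : NFSet.Elem (M := M) ⟨usc A.carrier⟩) :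
    ∃ x : A.Elem, z = singElem x := by
  obtain ⟨x, hx, e⟩ := mem_usc.1 z.2
  exact ⟨⟨x, hx⟩, Subtype.ext e⟩

theorem singElem_injective {A : NFSet M} {x y : A.Elem} (h : singElem x = singElem y) : x = y :=
  Subtype.ext (sing_injective (congrArg Subtype.val h))

/-- The function `{x} ↦ {f x}`. -/
noncomputable def TFun {A B : NFSet M} (f : A ⟶ B)
    (z : NFSet.Elem (M := M) ⟨usc A.carrier⟩) : NFSet.Elem (M := M) ⟨usc B.carrier⟩ :=
  singElem (app f (exists_eq_singElem z).choose)

theorem TFun_singElem {A B : NFSet M} (f : A ⟶ B) (x : A.Elem) :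
    TFun f (singElem x) = singElem (app f x) := by
  have h := singElem_injective (exists_eq_singElem (singElem x)).choose_spec
  rw [TFun, ← h]

theorem exists_TFun_graph {A B : NFSet M} (f : A ⟶ B) :
    ∃ G : M, ∀ p, p ∈ G ↔
      ∃ z : NFSet.Elem (M := M) ⟨usc A.carrier⟩, IsKPair z.1 (TFun f z).1 p := by
  obtain ⟨F, hF⟩ := NFSet.Hom.graph f
  -- variables: 0 the new pair, 1 2 the elements, 3 the old pair, 4 5 the singletons, 6 the graph;
  -- 7 is bound
  let σ : ℕ → ℕ := fun n => if n = 1 ∨ n = 2 ∨ n = 7 then 1 else if n = 4 ∨ n = 5 then 2 else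
    if n = 3 then 3 else if n = 0 ∨ n = 6 then 4 else if n = 20 then 2 else if n = 21 then 3 else 0
  have pair : Definable (M := M) σ (fun v => IsKPair (v 1) (v 2) (v 3)) := by
    have key : Definable (M := M) σ _ := Definable.all 4 ((Definable.mem 4 3 (by simp [σ])).iff
      ((Definable.all 7 ((Definable.mem 7 4 (by simp [σ])).iff (Definable.eq 7 1 (by simp [σ])))).or
        (Definable.all 7 ((Definable.mem 7 4 (by simp [σ])).iff
          ((Definable.eq 7 1 (by simp [σ])).or (Definable.eq 7 2 (by simp [σ])))))))
    exact key.congr fun v => by simp [IsKPair]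
  have h : Definable (M := M) σ _ := Definable.ex 1 (Definable.ex 2 (Definable.ex 3
    (Definable.ex 4 (Definable.ex 5
      (((Definable.mem 3 6 (by simp [σ])).and pair).and
      (((Definable.all 7 ((Definable.mem 7 4 (by simp [σ])).iff
          (Definable.eq 7 1 (by simp [σ])))).and
        (Definable.all 7 ((Definable.mem 7 5 (by simp [σ])).iff
          (Definable.eq 7 2 (by simp [σ]))))).and
      (definable_kpair 4 5 0 (by simp) (by simp) (by simp) (by simp [σ]) (by simp [σ])
        (by simp [σ]) (by simp [σ]))))))))
  obtain ⟨G, hG⟩ := h.exists_set (fun _ => F) 0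
  refine ⟨G, fun p => (hG p).trans ?_⟩
  simp only [Function.update_apply]
  constructor
  · rintro ⟨x, y, q, s, t, ⟨h1, h2⟩, ⟨h3, h4⟩, h5⟩
    obtain ⟨a, ha⟩ := (hF q).1 (by simpa using h1)
    obtain ⟨rfl, rfl⟩ := IsKPair.inj ha (by simpa using h2)
    obtain rfl : s = sing a.1 := eq_sing_iff.2 (by simpa using h3)
    obtain rfl : t = sing (app f a).1 := eq_sing_iff.2 (by simpa [app] using h4)
    exact ⟨singElem a, by rw [TFun_singElem]; simpa [singElem] using h5⟩
  · rintro ⟨z, hz⟩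
    obtain ⟨a, rfl⟩ := exists_eq_singElem z
    rw [TFun_singElem] at hz
    obtain ⟨q, hq⟩ := exists_kpair a.1 (app f a).1
    refine ⟨a.1, (app f a).1, q, sing a.1, sing (app f a).1, ⟨?_, by simpa using hq⟩,
      ⟨by simp [mem_sing], by simp [mem_sing]⟩, by simpa [singElem] using hz⟩
    simpa using (hF q).2 ⟨a, hq⟩

/-- The functor `T`, with `T A = {{x} | x ∈ A}` and `T f : {x} ↦ {f x}`. -/
noncomputable def T (M : Type u) [Model M] : NFSet M ⥤ NFSet M where
  obj A := ⟨usc A.carrier⟩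
  map f := NFSet.Hom.mk (TFun f) (exists_TFun_graph f)
  map_id A := hom_ext fun z => by
    obtain ⟨x, rfl⟩ := exists_eq_singElem z
    exact TFun_singElem (𝟙 A) x
  map_comp f g := hom_ext fun z => by
    obtain ⟨x, rfl⟩ := exists_eq_singElem z
    change TFun (f ≫ g) (singElem x) = TFun g (TFun f (singElem x))
    simp [TFun_singElem]

/-! ## Pseudo dependent products -/

variable {A B : NFSet M}

/-- A section of `D ⟶ A` over the fibre `f⁻¹{b}`: a function `s` from the fibre to `D` whose
composite with `D ⟶ A` is the identity of the fibre. -/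
structure FibreSection (f : A ⟶ B) (D : Over A) (b : B.Elem) where
  toFun : (a : A.Elem) → app f a = b → D.left.Elem
  proj : ∀ (a : A.Elem) (ha : app f a = b), app (B := A) D.hom (toFun a ha) = a

/-- The composite of a section with a morphism of the slice. -/
def FibreSection.comp {f : A ⟶ B} {D D' : Over A} {b : B.Elem} (s : FibreSection f D b)
    (h : D ⟶ D') : FibreSection f D' b where
  toFun a ha := app h.left (s.toFun a ha)
  proj a ha := by
    have e : app (B := A) D'.hom (app h.left (s.toFun a ha)) =
        app (B := A) (h.left ≫ D'.hom) (s.toFun a ha) := rfl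
    rw [e, Over.w h]
    exact s.proj a ha

/-- `g` is (the graph of) the section `s`, as a set of type-level pairs; so `g` has the same type
as the fibre. -/
def FibreSection.IsGraph {f : A ⟶ B} {D : Over A} {b : B.Elem} (s : FibreSection f D b)
    (g : M) : Prop :=
  ∀ p, p ∈ g ↔ ∃ (a : A.Elem) (ha : app f a = b), IsPair a.1 (s.toFun a ha).1 p

/-- `p` is the pair `⟨s, {b}⟩`, where `s` is a section over the fibre `f⁻¹{b}` whose graph is a
set. -/
def FibreSection.IsTagged {f : A ⟶ B} {D : Over A} {b : B.Elem} (s : FibreSection f D b)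
    (p : M) : Prop :=
  ∃ g : M, s.IsGraph g ∧ IsPair g (sing b.1) p

/-- The functor `P : N/A ⥤ N/TB` is the pseudo dependent product along `f`: its value at `D` is
`{⟨s, {b}⟩ | b ∈ B, s a section of D over f⁻¹{b}}` with the right projection to `T B`, and it
carries `h : D ⟶ D'` to `⟨s, {b}⟩ ↦ ⟨h ∘ s, {b}⟩`. -/
structure IsPseudoDependentProduct (f : A ⟶ B) (P : Over A ⥤ Over ((T M).obj B)) : Prop where
  mem_obj : ∀ (D : Over A) (p : M),
    p ∈ (P.obj D).left.carrier ↔ ∃ (b : B.Elem) (s : FibreSection f D b), s.IsTagged p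
  app_hom : ∀ (D : Over A) (p : (P.obj D).left.Elem) (b : B.Elem) (s : FibreSection f D b),
    s.IsTagged p.1 → app (B := (T M).obj B) (P.obj D).hom p = singElem b
  app_map : ∀ {D D' : Over A} (h : D ⟶ D') (p : (P.obj D).left.Elem) (b : B.Elem)
    (s : FibreSection f D b), s.IsTagged p.1 → (s.comp h).IsTagged (app (P.map h).left p).1

end Cat

end NF

/-! The only obstacle is stratification. A section `g` over `f⁻¹{b}`, as a set of type-level pairs,
lies one type above the elements of `A`, `B` and `D`. Hence `{b}`, and not `b`, has the type of `g`,
and the pair `⟨g, {b}⟩` has that type as well. Currying `m : f^*C ⟶ D` therefore cannot send `c` to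
its section, but it can send `{c}` to `⟨a ↦ m(c, a), {ρ c}⟩`; uncurrying `n` sends `(c, a)` to the
value at `a` of the section in `n {c}`. Both are relations between objects of one type, so they are
sets (`exists_transpose`, `transpose_surjective`), and the rest is the usual pointwise check that
pullback is adjoint to the dependent product.

Two supports carry this. The first is a calculus of stratified relations (`SD`) and terms (`Tm`),
ending in `SD.exists_set` and `exists_hom`. Each occurrence of a parameter gets a variable of its
own, so a parameter has no fixed type, and the graph of a morphism can be used at every type
(`SD.rel`).

The second is the injectivity of Quine's pair. It needs the successor to be injective on Frege
numerals, hence the axiom of infinity (`not_finiteUniv`). Suppose that the universe `V` is finite.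
The relation "`b` has cardinality two to the cardinality of `a`", read as `a ~ usc x` and `b ~ pow
x`, is then well-founded and has a kernel `L`: `b ∈ L` iff no predecessor of `b` is in `L`.
Exponentiation commutes with `usc`, so `x ∈ L` iff `usc x ∈ L`. But `pow V = V`, so up to
equinumerosity `usc V` is the only predecessor of `V`, and `V ∈ L` iff `usc V ∉ L`: a contradiction.
-/

namespace NF

/-! ## Stratified relations with parameters -/

section Renaming

/-- Renaming of the variables of a formula. -/
def Fml.rename (ρ : ℕ → ℕ) : Fml → Fml
  | .eq i j => .eq (ρ i) (ρ j)
  | .mem i j => .mem (ρ i) (ρ j)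
  | .neg φ => .neg (φ.rename ρ)
  | .and φ ψ => .and (φ.rename ρ) (ψ.rename ρ)
  | .all i φ => .all (ρ i) (φ.rename ρ)

/-- Bound variables are renamed too; injectivity of `ρ` ensures that an update at `ρ i` is seen by
the variable `i` alone. -/
theorem Fml.sat_rename {M : Type u} [Membership M M] {ρ : ℕ → ℕ} (hρ : Function.Injective ρ)
    (φ : Fml) (v : ℕ → M) : (φ.rename ρ).Sat v ↔ φ.Sat (v ∘ ρ) := by
  induction φ generalizing v with
  | eq i j => rfl
  | mem i j => rfl
  | neg φ ih => exact not_congr (ih v)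
  | and φ ψ ih ih' => exact and_congr (ih v) (ih' v)
  | all i φ ih =>
    refine forall_congr' fun x => (ih _).trans ?_
    rw [Function.update_comp_eq_of_injective _ hρ]

theorem Fml.stratifiedBy_rename {ρ σ : ℕ → ℕ} (φ : Fml) :
    (φ.rename ρ).StratifiedBy σ ↔ φ.StratifiedBy (σ ∘ ρ) := by
  induction φ with
  | eq i j => rfl
  | mem i j => rfl
  | neg φ ih => exact ih
  | and φ ψ ih ih' => exact and_congr ih ih'
  | all i φ ih => exact ih

end Renaming

/-- A typed context of bound variables, with the type `Γ` of its environments. -/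
inductive Ctx (M : Type u) : Type u → Type (u + 1)
  | nil : Ctx M PUnit
  | cons {Γ : Type u} (c : Ctx M Γ) (t : ℕ) : Ctx M (Γ × M)

/-! ### Environments as valuations of numbered variables -/

namespace Ctx

variable {M : Type u}

/-- `f` is a variable of type `t` of the context, or a parameter. -/
def Var : {Γ : Type u} → Ctx M Γ → (Γ → M) → ℕ → Prop
  | _, .nil, f, _ => ∃ a, f = fun _ => a
  | _, .cons c s, f, t => (∃ g, Var c g t ∧ f = fun e => g e.1) ∨ (t = s ∧ f = fun e => e.2)

/-- The number of variables of a context. -/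
def len : {Γ : Type u} → Ctx M Γ → ℕ
  | _, .nil => 0
  | _, .cons c _ => c.len + 1

/-- The valuation given by an environment for the bound variables and by `w` for the others. -/
def val : {Γ : Type u} → Ctx M Γ → Γ → (ℕ → M) → ℕ → M
  | _, .nil, _, w => w
  | _, .cons c _, e, w => Function.update (c.val e.1 w) c.len e.2

/-- The types of the variables of the context are given by `σ`. -/
def Agree : {Γ : Type u} → Ctx M Γ → (ℕ → ℕ) → Prop
  | _, .nil, _ => True
  | _, .cons c t, σ => c.Agree σ ∧ σ c.len = t

theorem var_const {Γ : Type u} (c : Ctx M Γ) (a : M) (t : ℕ) : c.Var (fun _ => a) t := by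
  induction c with
  | nil => exact ⟨a, rfl⟩
  | cons c s ih => exact Or.inl ⟨_, ih, rfl⟩

theorem val_of_le {Γ : Type u} (c : Ctx M Γ) (e : Γ) (w : ℕ → M) {k : ℕ} (hk : c.len ≤ k) :
    c.val e w k = w k := by
  induction c with
  | nil => rfl
  | cons c s ih =>
    change c.len + 1 ≤ k at hk
    change Function.update _ _ _ _ = _
    rw [Function.update_of_ne (by omega)]
    exact ih _ (by omega)

/-- Below `c.len` the environment overrides the valuation, so only the parameters, stored from
`c.len` on, matter. -/
theorem val_congr {Γ : Type u} (c : Ctx M Γ) (e : Γ) {w w' : ℕ → M}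
    (h : ∀ k, c.len ≤ k → w' k = w k) : c.val e w = c.val e w' := by
  have key : ∀ k < c.len, c.val e w k = c.val e w' k := by
    clear h
    induction c with
    | nil => exact fun k hk => absurd hk (Nat.not_lt_zero k)
    | cons c s ih =>
      intro k hk
      change Function.update (c.val e.1 w) c.len e.2 k = Function.update (c.val e.1 w') c.len e.2 k
      rcases Nat.lt_succ_iff_lt_or_eq.1 hk with hk | rfl
      · rw [Function.update_of_ne hk.ne, Function.update_of_ne hk.ne]
        exact ih _ k hk
      · simp
  funext k
  rcases lt_or_ge k c.len with hk | hk
  · exact key k hk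
  · rw [c.val_of_le e w hk, c.val_of_le e w' hk, h k hk]

theorem val_comp {Γ : Type u} (c : Ctx M Γ) (e : Γ) (w : ℕ → M) {ρ : ℕ → ℕ}
    (hρ : Function.Injective ρ) (h : ∀ k < c.len, ρ k = k) :
    c.val e w ∘ ρ = c.val e (w ∘ ρ) := by
  induction c with
  | nil => rfl
  | cons c s ih =>
    change ∀ k < c.len + 1, ρ k = k at h
    change Function.update (c.val e.1 w) c.len e.2 ∘ ρ
      = Function.update (c.val e.1 (w ∘ ρ)) c.len e.2
    rw [← ih _ fun k hk => h k (by omega), ← Function.update_comp_eq_of_injective _ hρ,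
      h c.len (by omega)]

theorem Agree.congr {Γ : Type u} {c : Ctx M Γ} {σ τ : ℕ → ℕ} (h : c.Agree σ)
    (e : ∀ k < c.len, τ k = σ k) : c.Agree τ := by
  induction c with
  | nil => trivial
  | cons c s ih =>
    change ∀ k < c.len + 1, τ k = σ k at e
    exact ⟨ih h.1 fun k hk => e k (by omega), (e _ (by omega)).trans h.2⟩

/-- The context forces the types of its variables. This lets the stratifications of two conjuncts be
glued. -/
theorem Agree.eq_of_lt {Γ : Type u} {c : Ctx M Γ} {σ τ : ℕ → ℕ} (h : c.Agree σ)
    (h' : c.Agree τ) {k : ℕ} (hk : k < c.len) : σ k = τ k := by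
  induction c with
  | nil => exact absurd hk (Nat.not_lt_zero k)
  | cons c s ih =>
    rcases Nat.lt_succ_iff_lt_or_eq.1 hk with hk | rfl
    · exact ih h.1 h'.1 hk
    · exact h.2.trans h'.2.symm

theorem exists_agree {Γ : Type u} (c : Ctx M Γ) : ∃ σ, c.Agree σ := by
  induction c with
  | nil => exact ⟨fun _ => 0, trivial⟩
  | cons c s ih =>
    obtain ⟨σ, h⟩ := ih
    exact ⟨Function.update σ c.len s,
      h.congr fun k hk => Function.update_of_ne (by omega) _ _, Function.update_self _ _ _⟩

theorem Var.cases {Γ : Type u} {c : Ctx M Γ} {f : Γ → M} {t : ℕ} (h : c.Var f t) :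
    (∃ a, f = fun _ => a) ∨ ∃ i < c.len, (∀ σ, c.Agree σ → σ i = t) ∧
      ∀ e w, c.val e w i = f e := by
  induction c with
  | nil => exact Or.inl h
  | cons c s ih =>
    rcases h with ⟨g, hg, rfl⟩ | ⟨rfl, rfl⟩
    · rcases ih hg with ⟨a, rfl⟩ | ⟨i, hi, h1, h2⟩
      · exact Or.inl ⟨a, rfl⟩
      · refine Or.inr ⟨i, Nat.lt_succ_of_lt hi, fun σ hσ => h1 σ hσ.1, fun e w => ?_⟩
        exact (Function.update_of_ne (by omega) _ _).trans (h2 _ _)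
    · exact Or.inr ⟨c.len, Nat.lt_succ_self _, fun σ hσ => hσ.2,
        fun e w => Function.update_self _ _ _⟩

/-- Two variables or parameters are given by indices for a common typing and valuation. -/
theorem Var.exists_index [Nonempty M] {Γ : Type u} {c : Ctx M Γ} {f g : Γ → M} {s t : ℕ}
    (hf : c.Var f s) (hg : c.Var g t) :
    ∃ (i j : ℕ) (σ : ℕ → ℕ) (w : ℕ → M), c.Agree σ ∧ σ i = s ∧ σ j = t ∧
      ∀ e, c.val e w i = f e ∧ c.val e w j = g e := by
  obtain ⟨σ, hσ⟩ := c.exists_agree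
  -- The indices `c.len` and `c.len + 1` are reserved for `f` and `g`, in case they are parameters;
  -- even equal parameters then get separate variables, hence independent types.
  let τ : ℕ → ℕ := fun k => if k < c.len then σ k else if k = c.len then s else t
  have hτ : c.Agree τ := hσ.congr fun k hk => by simp [τ, hk]
  have key : ∀ (f : Γ → M) (s k : ℕ), c.Var f s → c.len ≤ k → τ k = s →
      ∃ i a, τ i = s ∧ ∀ w : ℕ → M, w k = a → ∀ e, c.val e w i = f e := by
    intro f s k hf hk hs
    rcases hf.cases with ⟨a, rfl⟩ | ⟨i, -, h1, h2⟩
    · exact ⟨k, a, hs, fun w hw e => (c.val_of_le e w hk).trans hw⟩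
    · exact ⟨i, Classical.arbitrary M, h1 _ hτ, fun w _ e => h2 e w⟩
  obtain ⟨i, a, hi, hi'⟩ := key f s c.len hf le_rfl (by simp [τ])
  obtain ⟨j, b, hj, hj'⟩ := key g t (c.len + 1) hg (Nat.le_succ _) (by simp [τ])
  exact ⟨i, j, τ, fun k => if k = c.len then a else b, hτ, hi, hj,
    fun e => ⟨hi' _ (by simp) e, hj' _ (by simp) e⟩⟩

theorem var_zero {Γ : Type u} {c : Ctx M Γ} {t : ℕ} : (c.cons t).Var (fun e => e.2) t :=
  Or.inr ⟨rfl, rfl⟩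

theorem Var.succ {Γ : Type u} {c : Ctx M Γ} {f : Γ → M} {s t : ℕ} (hf : c.Var f t) :
    (c.cons s).Var (fun e => f e.1) t := Or.inl ⟨f, hf, rfl⟩

end Ctx

/-- Relations on the environments of a context that are given by a stratified formula with
parameters. A parameter may occur with several types. -/
inductive SD {M : Type u} [Membership M M] : {Γ : Type u} → Ctx M Γ → (Γ → Prop) → Prop
  | eqVar {Γ : Type u} {c : Ctx M Γ} {f g : Γ → M} {t : ℕ} :
      c.Var f t → c.Var g t → SD c (fun e => f e = g e)
  | memVar {Γ : Type u} {c : Ctx M Γ} {f g : Γ → M} {t : ℕ} :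
      c.Var f t → c.Var g (t + 1) → SD c (fun e => f e ∈ g e)
  | neg {Γ : Type u} {c : Ctx M Γ} {R : Γ → Prop} : SD c R → SD c (fun e => ¬ R e)
  | and {Γ : Type u} {c : Ctx M Γ} {R S : Γ → Prop} :
      SD c R → SD c S → SD c (fun e => R e ∧ S e)
  | allPair {Γ : Type u} {c : Ctx M Γ} {t : ℕ} {R : Γ × M → Prop} :
      SD (c.cons t) R → SD c (fun e => ∀ x, R (e, x))

/-! ### From stratified relations to stratified formulas -/

namespace SD

variable {M : Type u} [Membership M M] {Γ Δ : Type u} {c : Ctx M Γ} {d : Ctx M Δ}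
  {R S : Γ → Prop} {f g h : Γ → M} {t : ℕ}

theorem congr (hR : SD c R) (h : ∀ e, R e ↔ S e) : SD c S :=
  (funext fun e => propext (h e) : R = S) ▸ hR

/-- A map of environments that pulls variables back to variables acts as a renaming; under a
quantifier it is extended by the identity on the new variable. -/
theorem comap {k : Δ → Γ} (hR : SD c R) (hk : ∀ f t, c.Var f t → d.Var (fun e => f (k e)) t) :
    SD d (fun e => R (k e)) := by
  induction hR generalizing Δ with
  | eqVar hf hg => exact .eqVar (hk _ _ hf) (hk _ _ hg)
  | memVar hf hg => exact .memVar (hk _ _ hf) (hk _ _ hg)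
  | neg _ ih => exact .neg (ih hk)
  | and _ _ ih ih' => exact .and (ih hk) (ih' hk)
  | @allPair _ c s R _ ih =>
    refine .allPair (t := s) (R := fun e => R (k e.1, e.2))
      (ih (d := d.cons s) (k := fun e => (k e.1, e.2)) ?_)
    rintro f t (⟨g, hg, rfl⟩ | ⟨rfl, rfl⟩)
    · exact Or.inl ⟨_, hk _ _ hg, rfl⟩
    · exact Or.inr ⟨rfl, rfl⟩

/-- Only conjunction takes work: the two formulas share the bound variables, but their parameters
may clash in value or in type and have to be moved apart. -/
theorem exists_formula [Nonempty M] (hR : SD c R) : ∃ (φ : Fml) (σ : ℕ → ℕ) (w : ℕ → M),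
    φ.StratifiedBy σ ∧ c.Agree σ ∧ ∀ e, R e ↔ φ.Sat (c.val e w) := by
  induction hR with
  | eqVar hf hg =>
    obtain ⟨i, j, σ, w, hσ, hi, hj, hw⟩ := hf.exists_index hg
    exact ⟨.eq i j, σ, w, hi.trans hj.symm, hσ, fun e => by simp [Fml.Sat, hw]⟩
  | memVar hf hg =>
    obtain ⟨i, j, σ, w, hσ, hi, hj, hw⟩ := hf.exists_index hg
    exact ⟨.mem i j, σ, w, by simp [Fml.StratifiedBy, hi, hj], hσ, fun e => by
      simp [Fml.Sat, hw]⟩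
  | neg _ ih =>
    obtain ⟨φ, σ, w, h1, h2, h3⟩ := ih
    exact ⟨.neg φ, σ, w, h1, h2, fun e => not_congr (h3 e)⟩
  | @and _ c _ _ _ _ ih ih' =>
    obtain ⟨φ, σ, w, h1, h2, h3⟩ := ih
    obtain ⟨ψ, τ, w', h1', h2', h3'⟩ := ih'
    -- Parameters of the left formula go to even offsets above `c.len`, those of the right one to
    -- odd offsets; bound variables stay fixed.
    let ρ : ℕ → ℕ := fun k => if k < c.len then k else c.len + 2 * (k - c.len)
    let ρ' : ℕ → ℕ := fun k => if k < c.len then k else c.len + 2 * (k - c.len) + 1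
    have hρ : Function.Injective ρ := fun a b h => by
      simp only [ρ] at h; split_ifs at h <;> omega
    have hρ' : Function.Injective ρ' := fun a b h => by
      simp only [ρ'] at h; split_ifs at h <;> omega
    have merge : ∀ {X : Type u} (a b : ℕ → X), ∃ z : ℕ → X,
        (∀ k, c.len ≤ k → z (ρ k) = a k) ∧ ∀ k, c.len ≤ k → z (ρ' k) = b k := by
      intro X a b
      refine ⟨fun k => if (k - c.len) % 2 = 0 then a (c.len + (k - c.len) / 2)
        else b (c.len + (k - c.len) / 2), fun k hk => ?_, fun k hk => ?_⟩
      · have e1 : ρ k = c.len + 2 * (k - c.len) := by simp [ρ, hk.not_gt]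
        have e2 : (ρ k - c.len) % 2 = 0 := by omega
        have e3 : c.len + (ρ k - c.len) / 2 = k := by omega
        simp [e2, e3]
      · have e1 : ρ' k = c.len + 2 * (k - c.len) + 1 := by simp [ρ', hk.not_gt]
        have e2 : ¬ (ρ' k - c.len) % 2 = 0 := by omega
        have e3 : c.len + (ρ' k - c.len) / 2 = k := by omega
        simp only [e2, e3, if_false]
    have hlt : ∀ k < c.len, ρ k = k := fun k hk => by simp [ρ, hk]
    have hlt' : ∀ k < c.len, ρ' k = k := fun k hk => by simp [ρ', hk]
    -- The same interleaving serves the types and the values of the parameters; `ULift` brings the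
    -- types into the universe of `M`.
    obtain ⟨z, hz, hz'⟩ := merge (fun k => ULift.up (σ k)) (fun k => ULift.up (τ k))
    obtain ⟨x, hx, hx'⟩ := merge w w'
    let θ : ℕ → ℕ := fun k => if k < c.len then σ k else (z k).down
    have hge : ∀ k, c.len ≤ k → ¬ ρ k < c.len := fun k hk => by simp [ρ, hk.not_gt]
    have hge' : ∀ k, c.len ≤ k → ¬ ρ' k < c.len := fun k hk => by
      simp only [ρ', hk.not_gt, if_false]; omega
    have e1 : θ ∘ ρ = σ := funext fun k => by
      rcases lt_or_ge k c.len with hk | hk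
      · simp [θ, hlt k hk, hk]
      · simp [θ, hge k hk, hz k hk]
    have e2 : θ ∘ ρ' = τ := funext fun k => by
      rcases lt_or_ge k c.len with hk | hk
      · simp [θ, hlt' k hk, hk, h2.eq_of_lt h2' hk]
      · simp [θ, hge' k hk, hz' k hk]
    refine ⟨.and (φ.rename ρ) (ψ.rename ρ'), θ, x,
      ⟨φ.stratifiedBy_rename.2 (e1 ▸ h1), ψ.stratifiedBy_rename.2 (e2 ▸ h1')⟩,
      h2.congr fun k hk => by simp [θ, hk], fun e => ?_⟩
    refine and_congr ((h3 e).trans ?_) ((h3' e).trans ?_)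
    · rw [Fml.sat_rename hρ, c.val_comp e x hρ hlt,
        c.val_congr e (w := w) (w' := x ∘ ρ) hx]
    · rw [Fml.sat_rename hρ', c.val_comp e x hρ' hlt',
        c.val_congr e (w := w') (w' := x ∘ ρ') hx']
  | @allPair _ c t R _ ih =>
    obtain ⟨φ, σ, w, h1, h2, h3⟩ := ih
    exact ⟨.all c.len φ, σ, w, h1, h2.1, fun e => forall_congr' fun x => h3 (e, x)⟩

theorem imp (hR : SD c R) (hS : SD c S) : SD c (fun e => R e → S e) :=
  (neg (and hR (neg hS))).congr fun e => by tauto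

theorem or (hR : SD c R) (hS : SD c S) : SD c (fun e => R e ∨ S e) :=
  (neg (and (neg hR) (neg hS))).congr fun e => by tauto

theorem iff (hR : SD c R) (hS : SD c S) : SD c (fun e => (R e ↔ S e)) :=
  (and (imp hR hS) (imp hS hR)).congr fun e => by tauto

theorem all {R : Γ → M → Prop} (hR : SD (c.cons t) (fun e => R e.1 e.2)) :
    SD c (fun e => ∀ x, R e x) := allPair hR

theorem ex {R : Γ → M → Prop} (hR : SD (c.cons t) (fun e => R e.1 e.2)) :
    SD c (fun e => ∃ x, R e x) :=
  (neg (all (R := fun e x => ¬ R e x) (neg hR))).congr fun e => by simp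

end SD

/-- The function `f` on environments is definable, with values of type `t`. -/
structure Tm {M : Type u} [Membership M M] {Γ : Type u} (c : Ctx M Γ) (f : Γ → M) (t : ℕ) :
    Prop where
  sd : SD (c.cons t) (fun e => e.2 = f e.1)

/-! ### Definable terms and substitution -/

section Terms

variable {M : Type u} [Membership M M] {Γ Δ : Type u} {c : Ctx M Γ} {d : Ctx M Δ}
  {R S : Γ → Prop} {f g h : Γ → M} {t s r q p : ℕ}

theorem Ctx.Var.tm (hf : c.Var f t) : Tm c f t :=
  ⟨.eqVar (t := t) (Or.inr ⟨rfl, rfl⟩) (Or.inl ⟨f, hf, rfl⟩)⟩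

theorem Tm.const (a : M) : Tm c (fun _ => a) t := (c.var_const a t).tm

theorem Tm.var0 : Tm (c.cons t) (fun e => e.2) t := Ctx.var_zero.tm

theorem Tm.weaken (hf : Tm c f t) : Tm (c.cons s) (fun e => f e.1) t :=
  ⟨SD.comap (k := fun e : (Γ × M) × M => (e.1.1, e.2)) hf.sd fun g _ hg => by
    rcases hg with ⟨g, hg, rfl⟩ | ⟨rfl, rfl⟩
    · exact hg.succ.succ
    · exact Ctx.var_zero⟩

theorem Tm.var1 : Tm ((c.cons t).cons s) (fun e => e.1.2) t := Tm.var0.weaken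

theorem Tm.var2 : Tm (((c.cons t).cons s).cons r) (fun e => e.1.1.2) t := Tm.var1.weaken

theorem Tm.var3 : Tm ((((c.cons t).cons s).cons r).cons q) (fun e => e.1.1.1.2) t :=
  Tm.var2.weaken

theorem Tm.var4 : Tm (((((c.cons t).cons s).cons r).cons q).cons p) (fun e => e.1.1.1.1.2) t :=
  Tm.var3.weaken

/-- Substitution of a term for a variable. -/
theorem SD.subst {R : Γ → M → Prop} (hR : SD (c.cons t) (fun e => R e.1 e.2)) (hf : Tm c f t) :
    SD c (fun e => R e (f e)) :=
  (SD.ex (R := fun e x => x = f e ∧ R e x) (.and hf.sd hR)).congr fun e => by simp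

theorem SD.eq (hf : Tm c f t) (hg : Tm c g t) : SD c (fun e => f e = g e) :=
  SD.subst (R := fun e x => x = g e) hg.sd hf

theorem SD.mem (hf : Tm c f t) (hg : Tm c g (t + 1)) : SD c (fun e => f e ∈ g e) :=
  SD.subst (R := fun e x => x ∈ g e) (SD.subst (R := fun e y => e.2 ∈ y)
    (.memVar (t := t) Ctx.var_zero.succ Ctx.var_zero) hg.weaken) hf

/-- Substitution of a term in a closed predicate. -/
theorem SD.subst₁ {R : M → Prop} (hR : SD ((Ctx.nil (M := M)).cons t) (fun e => R e.2))
    (hf : Tm c f t) : SD c (fun e => R (f e)) :=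
  SD.subst (R := fun _ x => R x)
    (hR.comap (k := fun e : Γ × M => (PUnit.unit, e.2)) fun g _ hg => by
      rcases hg with ⟨g, ⟨a, rfl⟩, rfl⟩ | ⟨rfl, rfl⟩
      · exact Ctx.var_const _ a _
      · exact Ctx.var_zero) hf

/-- Substitution of terms in a closed binary relation. -/
theorem SD.subst₂ {R : M → M → Prop}
    (hR : SD (((Ctx.nil (M := M)).cons t).cons s) (fun e => R e.1.2 e.2))
    (hf : Tm c f t) (hg : Tm c g s) : SD c (fun e => R (f e) (g e)) :=
  SD.subst (R := fun e x => R x (g e)) (SD.subst (R := fun e y => R e.2 y)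
    (hR.comap (k := fun e : (Γ × M) × M => ((PUnit.unit, e.1.2), e.2)) fun g _ hg => by
      rcases hg with ⟨g, ⟨g, ⟨a, rfl⟩, rfl⟩ | ⟨rfl, rfl⟩, rfl⟩ | ⟨rfl, rfl⟩
      · exact Ctx.var_const _ a _
      · exact Ctx.var_zero.succ
      · exact Ctx.var_zero) hg.weaken) hf

end Terms

/-- The single variable of the context has number `0`, and all parameters are supplied by the
valuation `w`, so this is one instance of comprehension. -/
theorem SD.exists_set {M : Type u} [Model M] {R : M → Prop} (t : ℕ)
    (hR : SD ((Ctx.nil (M := M)).cons t) (fun e => R e.2)) : ∃ y : M, ∀ z, z ∈ y ↔ R z := by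
  have : Nonempty M := Model.nonempty
  obtain ⟨φ, σ, w, h1, -, h3⟩ := hR.exists_formula
  obtain ⟨y, hy⟩ := Model.comprehension φ σ h1 w 0
  exact ⟨y, fun z => (hy z).trans (h3 (PUnit.unit, z)).symm⟩

/-! ### Kuratowski pairs and relations coded by sets -/

section Sets

variable {M : Type u} [Model M] {Γ : Type u} {c : Ctx M Γ} {f g h : Γ → M} {t : ℕ}

theorem SD.kpair (hf : Tm c f t) (hg : Tm c g t) (hh : Tm c h (t + 2)) :
    SD c (fun e => IsKPair (f e) (g e) (h e)) := by
  unfold IsKPair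
  refine .all (.iff (.mem .var0 hh.weaken) (.or ?_ ?_))
  · exact .all (.iff (.mem (t := t) .var0 .var1) (.eq .var0 hf.weaken.weaken))
  · exact .all (.iff (.mem (t := t) .var0 .var1)
      (.or (.eq .var0 hf.weaken.weaken) (.eq .var0 hg.weaken.weaken)))

theorem Tm.sing (hf : Tm c f t) : Tm c (fun e => sing (f e)) (t + 1) := by
  refine ⟨?_⟩
  simp only [eq_sing_iff]
  exact .all (.iff (.mem .var0 .var1) (.eq .var0 hf.weaken.weaken))

/-- The relation `R` is given by a set of pairs. -/
def IsRel (R : M → M → Prop) : Prop := ∃ G : M, ∀ a b, R a b ↔ ∃ p, IsKPair a b p ∧ p ∈ G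

theorem SD.exists_graph {R : M → M → Prop}
    (hR : SD (((Ctx.nil (M := M)).cons t).cons t) (fun e => R e.1.2 e.2)) :
    ∃ G : M, ∀ p, p ∈ G ↔ ∃ a b, IsKPair a b p ∧ R a b :=
  SD.exists_set (t + 2) <| .ex <| .ex <| .and (.kpair .var1 .var0 .var2) (.subst₂ hR .var1 .var0)

theorem SD.isRel {R : M → M → Prop}
    (hR : SD (((Ctx.nil (M := M)).cons t).cons t) (fun e => R e.1.2 e.2)) : IsRel R := by
  obtain ⟨G, hG⟩ := hR.exists_graph
  refine ⟨G, fun a b => ?_⟩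
  constructor
  · intro h
    obtain ⟨p, hp⟩ := exists_kpair a b
    exact ⟨p, hp, (hG p).2 ⟨a, b, hp, h⟩⟩
  · rintro ⟨p, hp, h⟩
    obtain ⟨a', b', hp', h'⟩ := (hG p).1 h
    obtain ⟨rfl, rfl⟩ := hp.inj hp'
    exact h'

/-- The code `G` enters as a parameter, which has no fixed type; hence `t` is arbitrary and may
differ from one use to the next. -/
theorem SD.rel {R : M → M → Prop} (hR : IsRel R) (hf : Tm c f t) (hg : Tm c g t) :
    SD c (fun e => R (f e) (g e)) := by
  obtain ⟨G, hG⟩ := hR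
  simp only [hG]
  exact .ex (.and (.kpair hf.weaken hg.weaken .var0) (.mem .var0 (.const G)))

end Sets

/-! ### Frege natural numbers and finite sets -/

section Naturals

variable {M : Type u} [Model M] {Γ : Type u} {c : Ctx M Γ} {f g h : Γ → M} {t : ℕ}

theorem SD.isZero (hf : Tm c f (t + 2)) : SD c (fun e => IsZero (f e)) := by
  unfold IsZero
  exact .all (.iff (.mem .var0 hf.weaken) (.all (.neg (.mem .var0 .var1))))

theorem SD.isSucc (hf : Tm c f (t + 2)) (hg : Tm c g (t + 2)) :
    SD c (fun e => IsSucc (f e) (g e)) := by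
  unfold IsSucc
  exact .all (.iff (.mem .var0 hg.weaken) (.ex (.and (.mem .var0 hf.weaken.weaken)
    (.ex (.and (.neg (.mem .var0 .var1))
      (.all (.iff (.mem .var0 .var3) (.or (.mem .var0 .var2) (.eq .var0 .var1)))))))))

theorem SD.isNat (hf : Tm c f (t + 2)) : SD c (fun e => IsNat (f e)) := by
  unfold IsNat
  exact .all (.imp (.all (.imp (.isZero .var0) (.mem .var0 .var1)))
    (.imp (.all (.imp (.mem .var0 .var1) (.all (.imp (.isSucc .var1 .var0) (.mem .var0 .var2)))))
      (.mem hf.weaken .var0)))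

theorem exists_zero : ∃ z : M, IsZero z :=
  SD.exists_set 1 (.all (.neg (.mem .var0 .var1)))

theorem exists_succ (n : M) : ∃ m : M, IsSucc n m :=
  SD.exists_set 1 (.ex (.and (.mem .var0 (.const n)) (.ex (.and (.neg (.mem .var0 .var1))
      (.all (.iff (.mem .var0 .var3) (.or (.mem .var0 .var2) (.eq .var0 .var1))))))))

theorem IsZero.unique {z z' : M} (h : IsZero z) (h' : IsZero z') : z = z' :=
  Model.ext _ _ fun x => (h x).trans (h' x).symm

theorem IsSucc.unique {n m m' : M} (h : IsSucc n m) (h' : IsSucc n m') : m = m' :=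
  Model.ext _ _ fun x => (h x).trans (h' x).symm

theorem IsZero.isNat {z : M} (h : IsZero z) : IsNat z := fun _ h0 _ => h0 z h

theorem IsNat.succ {n m : M} (hn : IsNat n) (h : IsSucc n m) : IsNat m :=
  fun X h0 h1 => h1 n (hn X h0 h1) m h

/-- Induction for stratified properties of natural numbers. -/
theorem IsNat.induction {P : M → Prop} (t : ℕ)
    (hP : SD ((Ctx.nil (M := M)).cons (t + 2)) (fun e => P e.2)) (h0 : ∀ z, IsZero z → P z)
    (h1 : ∀ n m, IsNat n → P n → IsSucc n m → P m) {n : M} (hn : IsNat n) : P n := by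
  -- Adding `IsNat n` to the inductive set makes it available in the induction step.
  obtain ⟨X, hX⟩ := SD.exists_set (R := fun n => IsNat n ∧ P n) (t + 2) (.and (SD.isNat .var0) hP)
  exact ((hX n).1 (hn X (fun z hz => (hX z).2 ⟨hz.isNat, h0 z hz⟩) fun k hk m hm =>
    (hX m).2 ⟨((hX k).1 hk).1.succ hm, h1 k m ((hX k).1 hk).1 ((hX k).1 hk).2 hm⟩)).2

theorem IsNat.cases {n : M} (hn : IsNat n) : IsZero n ∨ ∃ k, IsNat k ∧ IsSucc k n :=
  hn.induction (P := fun n => IsZero n ∨ ∃ k, IsNat k ∧ IsSucc k n) 0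
    (.or (.isZero .var0) (.ex (.and (.isNat .var0) (.isSucc .var0 .var1))))
    (fun _ h => Or.inl h) fun _ _ hk _ h => Or.inr ⟨_, hk, h⟩

theorem IsSucc.nonempty {n m x : M} (h : IsSucc n m) (hx : x ∈ m) : ∃ y, y ∈ x := by
  obtain ⟨u, -, y, -, h⟩ := (h x).1 hx
  exact ⟨y, (h y).2 (Or.inr rfl)⟩

theorem IsSucc.not_isZero {n m : M} (h : IsSucc n m) : ¬ IsZero m := by
  intro h0
  obtain ⟨e, he⟩ := SD.exists_set (M := M) (R := fun _ => False) 0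
    (SD.congr (.neg (.eq .var0 .var0)) fun _ => by simp)
  obtain ⟨y, hy⟩ := h.nonempty ((h0 e).2 fun y hy => (he y).1 hy)
  exact (he y).1 hy

/-! ### Adjoining and removing an element -/

theorem exists_insert (u y : M) : ∃ s : M, ∀ z, z ∈ s ↔ z ∈ u ∨ z = y :=
  SD.exists_set 0 (.or (.mem .var0 (.const u)) (.eq .var0 (.const y)))

/-- The set `u ∪ {y}`. -/
noncomputable def ins (u y : M) : M := (exists_insert u y).choose

@[simp] theorem mem_ins {u y z : M} : z ∈ ins u y ↔ z ∈ u ∨ z = y :=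
  (exists_insert u y).choose_spec z

theorem exists_remove (u y : M) : ∃ s : M, ∀ z, z ∈ s ↔ z ∈ u ∧ z ≠ y :=
  SD.exists_set 0 (.and (.mem .var0 (.const u)) (.neg (.eq .var0 (.const y))))

/-- The set `u \ {y}`. -/
noncomputable def rem (u y : M) : M := (exists_remove u y).choose

@[simp] theorem mem_rem {u y z : M} : z ∈ rem u y ↔ z ∈ u ∧ z ≠ y :=
  (exists_remove u y).choose_spec z

theorem Tm.rem (hf : Tm c f (t + 1)) (hg : Tm c g t) : Tm c (fun e => rem (f e) (g e)) (t + 1) := by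
  have key : ∀ x u y : M, x = NF.rem u y ↔ ∀ z, z ∈ x ↔ z ∈ u ∧ z ≠ y := fun x u y =>
    ⟨fun h z => h ▸ mem_rem, fun h => Model.ext _ _ fun z => (h z).trans mem_rem.symm⟩
  refine ⟨?_⟩
  simp only [key]
  exact .all (.iff (.mem .var0 .var1) (.and (.mem .var0 hf.weaken.weaken)
    (.neg (.eq .var0 hg.weaken.weaken))))

theorem ins_rem {u y : M} (h : y ∈ u) : ins (rem u y) y = u :=
  Model.ext _ _ fun z => by by_cases hz : z = y <;> simp [hz, h]

theorem rem_ins {u y : M} (h : y ∉ u) : rem (ins u y) y = u :=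
  Model.ext _ _ fun z => by
    by_cases hz : z = y <;> simp [hz, h]

theorem rem_ins_comm {u y z : M} (h : y ≠ z) : rem (ins u z) y = ins (rem u y) z :=
  Model.ext _ _ fun w => by
    simp only [mem_rem, mem_ins]
    constructor
    · rintro ⟨h1 | h1, h2⟩
      · exact Or.inl ⟨h1, h2⟩
      · exact Or.inr h1
    · rintro (⟨h1, h2⟩ | rfl)
      · exact ⟨Or.inl h1, h2⟩
      · exact ⟨Or.inr rfl, h.symm⟩

theorem isSucc_iff {n m : M} :
    IsSucc n m ↔ ∀ x, x ∈ m ↔ ∃ u ∈ n, ∃ y, y ∉ u ∧ x = ins u y := by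
  have key : ∀ x u y : M, (∀ w, w ∈ x ↔ w ∈ u ∨ w = y) ↔ x = ins u y := fun x u y =>
    ⟨fun h => Model.ext _ _ fun z => (h z).trans mem_ins.symm, fun h z => h ▸ mem_ins⟩
  simp only [IsSucc, key]

theorem IsSucc.ins_mem {n m u y : M} (h : IsSucc n m) (hu : u ∈ n) (hy : y ∉ u) : ins u y ∈ m :=
  (isSucc_iff.1 h _).2 ⟨u, hu, y, hy, rfl⟩

/-- The removed `y` need not be the element `w` that was adjoined last. If it is not, `y` is removed
from the smaller set by induction and `w` is adjoined again. -/
theorem IsNat.rem_mem {n : M} (hn : IsNat n) :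
    ∀ m, IsSucc n m → ∀ x ∈ m, ∀ y ∈ x, rem x y ∈ n := by
  refine hn.induction (P := fun n => ∀ m, IsSucc n m → ∀ x ∈ m, ∀ y ∈ x, rem x y ∈ n) 0
    (.all (.imp (.isSucc .var1 .var0) (.all (.imp (.mem .var0 .var1) (.all (.imp (.mem .var0 .var1)
      (.mem (.rem .var1 .var0) .var3))))))) ?_ ?_
  · intro z hz m hm x hx y hy
    obtain ⟨u, hu, w, -, rfl⟩ := (isSucc_iff.1 hm x).1 hx
    have hu := (hz u).1 hu
    refine (hz _).2 fun v hv => ?_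
    simp only [mem_rem, mem_ins, hu, false_or] at hv hy
    exact hv.2 (hv.1.trans hy.symm)
  · intro n k hn ih hk m hm x hx y hy
    obtain ⟨u, hu, w, hw, rfl⟩ := (isSucc_iff.1 hm x).1 hx
    by_cases hyw : y = w
    · subst hyw
      rwa [rem_ins hw]
    · have hyu : y ∈ u := (mem_ins.1 hy).resolve_right hyw
      rw [rem_ins_comm hyw]
      exact hk.ins_mem (ih k hk u hu y hyu) fun h => hw (mem_rem.1 h).1

/-- Distinct numerals are disjoint: removing an element from a common member gives a common member
of the predecessors. -/
theorem IsNat.eq_of_mem {n : M} (hn : IsNat n) :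
    ∀ m, IsNat m → ∀ x ∈ n, x ∈ m → n = m := by
  refine hn.induction (P := fun n => ∀ m, IsNat m → ∀ x ∈ n, x ∈ m → n = m) 0
    (.all (.imp (.isNat .var0) (.all (.imp (.mem .var0 .var2)
      (.imp (.mem .var0 .var1) (.eq .var2 .var1)))))) ?_ ?_
  · intro z hz m hm x hx hxm
    rcases hm.cases with h0 | ⟨k, -, hk⟩
    · exact hz.unique h0
    · obtain ⟨y, hy⟩ := hk.nonempty hxm
      exact ((hz x).1 hx y hy).elim
  · intro n n' hn ih hn' m hm x hx hxm
    obtain ⟨y, hy⟩ := hn'.nonempty hx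
    rcases hm.cases with h0 | ⟨k, hk, hkm⟩
    · exact ((h0 x).1 hxm y hy).elim
    · have := ih k hk (rem x y) (hn.rem_mem _ hn' x hx y hy) (hk.rem_mem _ hkm x hxm y hy)
      subst this
      exact hn'.unique hkm

theorem IsNat.eq_of_subset {n : M} (hn : IsNat n) :
    ∀ x ∈ n, ∀ y ∈ n, (∀ z, z ∈ y → z ∈ x) → y = x := by
  refine hn.induction (P := fun n => ∀ x ∈ n, ∀ y ∈ n, (∀ z, z ∈ y → z ∈ x) → y = x) 0
    (.all (.imp (.mem .var0 .var1) (.all (.imp (.mem .var0 .var2)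
      (.imp (.all (.imp (.mem .var0 .var1) (.mem .var0 .var2))) (.eq .var0 .var1)))))) ?_ ?_
  · intro z hz x hx y hy _
    exact Model.ext _ _ fun w => iff_of_false ((hz y).1 hy w) ((hz x).1 hx w)
  · intro n m hn ih hm x hx y hy hs
    obtain ⟨w, hw⟩ := hm.nonempty hy
    rw [← ins_rem hw, ← ins_rem (hs w hw)]
    congr 1
    refine ih _ (hn.rem_mem _ hm x hx w (hs w hw)) _ (hn.rem_mem _ hm y hy w hw) fun z hz => ?_
    rw [mem_rem] at hz ⊢
    exact ⟨hs z hz.1, hz.2⟩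

/-- Strong induction, along proper inclusion, over the subsets of a finite set. -/
theorem IsNat.strong_induction {P : M → Prop} (t : ℕ)
    (hP : SD ((Ctx.nil (M := M)).cons (t + 1)) (fun e => P e.2))
    (h : ∀ x, (∀ y, (∀ z, z ∈ y → z ∈ x) → y ≠ x → P y) → P x) {n : M} (hn : IsNat n) :
    ∀ x ∈ n, ∀ y, (∀ z, z ∈ y → z ∈ x) → P y := by
  refine hn.induction (P := fun n => ∀ x ∈ n, ∀ y, (∀ z, z ∈ y → z ∈ x) → P y) t
    (.all (.imp (.mem .var0 .var1) (.all (.imp (.all (.imp (.mem .var0 .var1) (.mem .var0 .var2)))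
      (.subst₁ hP .var0))))) ?_ ?_
  · intro z hz x hx y hy
    have hx := (hz x).1 hx
    refine h y fun w hw hne => (hne ?_).elim
    exact Model.ext _ _ fun v => iff_of_false (fun hv => hx v (hy v (hw v hv)))
      fun hv => hx v (hy v hv)
  · intro n m hn ih hm x hx
    -- A proper subset of `x` misses some `w ∈ x`, so it lies in `rem x w`, which is a member of
    -- `n`.
    have key : ∀ y, (∀ z, z ∈ y → z ∈ x) → y ≠ x → P y := by
      intro y hy hne
      by_contra hP
      refine hne (Model.ext _ _ fun w => ⟨hy w, fun hw => by_contra fun hwy => hP ?_⟩)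
      exact ih _ (hn.rem_mem _ hm x hx w hw) y fun z hz =>
        mem_rem.2 ⟨hy z hz, fun e => hwy (e ▸ hz)⟩
    intro y hy
    by_cases hne : y = x
    · exact hne ▸ h x key
    · exact key y hy hne

end Naturals

/-! ## Equinumerosity -/

section Equinumerosity

variable {M : Type u} [Model M] {Γ : Type u} {c : Ctx M Γ} {f g h : Γ → M} {t : ℕ}
  {x y z u : M} {R : M → M → Prop}

/-- `R` restricts to a bijection between `x` and `y`. -/
def Bij (R : M → M → Prop) (x y : M) : Prop :=
  (∀ a, a ∈ x → ∃ b, b ∈ y ∧ R a b) ∧ (∀ b, b ∈ y → ∃ a, a ∈ x ∧ R a b) ∧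
    ∀ a, a ∈ x → ∀ a', a' ∈ x → ∀ b, b ∈ y → ∀ b', b' ∈ y → R a b → R a' b' → (a = a' ↔ b = b')

/-- There is a set that is a bijection between `x` and `y`. -/
def Eqv (x y : M) : Prop := ∃ R, IsRel R ∧ Bij R x y

/-- The quantifier over relations becomes one over codes: elements have type `t`, Kuratowski pairs
`t + 2`, the code `t + 3`. -/
theorem SD.eqv (hf : Tm c f (t + 1)) (hg : Tm c g (t + 1)) : SD c (fun e => Eqv (f e) (g e)) := by
  have key : ∀ x y : M, Eqv x y ↔ ∃ G : M, Bij (fun a b => ∃ p, IsKPair a b p ∧ p ∈ G) x y := by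
    intro x y
    constructor
    · rintro ⟨R, ⟨G, hG⟩, h⟩
      refine ⟨G, ?_⟩
      simpa only [← hG] using h
    · rintro ⟨G, h⟩
      exact ⟨_, ⟨G, fun _ _ => Iff.rfl⟩, h⟩
  simp only [key, Bij]
  have pr : ∀ {Δ : Type u} {d : Ctx M Δ} {a b G : Δ → M}, Tm d a t → Tm d b t → Tm d G (t + 3) →
      SD d (fun e => ∃ p, IsKPair (a e) (b e) p ∧ p ∈ G e) := fun ha hb hG =>
    .ex (.and (.kpair ha.weaken hb.weaken .var0) (.mem .var0 hG.weaken))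
  refine .ex (.and (.all (.imp (.mem .var0 hf.weaken.weaken)
    (.ex (.and (.mem .var0 hg.weaken.weaken.weaken) (pr .var1 .var0 .var2))))) (.and
    (.all (.imp (.mem .var0 hg.weaken.weaken)
      (.ex (.and (.mem .var0 hf.weaken.weaken.weaken) (pr .var0 .var1 .var2)))))
    (.all (.imp (.mem .var0 hf.weaken.weaken) (.all (.imp (.mem .var0 hf.weaken.weaken.weaken)
      (.all (.imp (.mem .var0 hg.weaken.weaken.weaken.weaken)
        (.all (.imp (.mem .var0 hg.weaken.weaken.weaken.weaken.weaken)
          (.imp (pr .var3 .var1 .var4) (.imp (pr .var2 .var0 .var4)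
            (.iff (.eq .var3 .var2) (.eq .var1 .var0))))))))))))))

theorem isRel_eq : IsRel (fun a b : M => a = b) := SD.isRel (t := 0) (.eq .var1 .var0)

theorem IsRel.swap (h : IsRel R) : IsRel (fun a b => R b a) :=
  SD.isRel (t := 0) (.rel h .var0 .var1)

theorem Eqv.refl (x : M) : Eqv x x :=
  ⟨_, isRel_eq, fun a ha => ⟨a, ha, rfl⟩, fun a ha => ⟨a, ha, rfl⟩, by
    rintro a - a' - b - b' - rfl rfl; rfl⟩

theorem Eqv.symm (h : Eqv x y) : Eqv y x := by
  obtain ⟨R, hR, h1, h2, h3⟩ := h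
  exact ⟨_, hR.swap, h2, h1, fun b hb b' hb' a ha a' ha' e e' =>
    (h3 a ha a' ha' b hb b' hb' e e').symm⟩

theorem Eqv.trans (h : Eqv x y) (h' : Eqv y z) : Eqv x z := by
  obtain ⟨R, hR, h1, h2, h3⟩ := h
  obtain ⟨S, hS, h1', h2', h3'⟩ := h'
  refine ⟨fun a k => ∃ b, b ∈ y ∧ R a b ∧ S b k, SD.isRel (t := 0) (.ex (.and
    (.mem .var0 (.const y)) (.and (.rel hR .var2 .var0) (.rel hS .var0 .var1)))), ?_, ?_, ?_⟩
  · intro a ha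
    obtain ⟨b, hb, e⟩ := h1 a ha
    obtain ⟨k, hk, e'⟩ := h1' b hb
    exact ⟨k, hk, b, hb, e, e'⟩
  · intro k hk
    obtain ⟨b, hb, e⟩ := h2' k hk
    obtain ⟨a, ha, e'⟩ := h2 b hb
    exact ⟨a, ha, b, hb, e', e⟩
  · rintro a ha a' ha' k hk k' hk' ⟨b, hb, e1, e2⟩ ⟨b', hb', e1', e2'⟩
    exact (h3 a ha a' ha' b hb b' hb' e1 e1').trans (h3' b hb b' hb' k hk k' hk' e2 e2')

theorem Eqv.exists_subset (h : Eqv x y) (hu : ∀ a, a ∈ u → a ∈ x) :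
    ∃ v, (∀ b, b ∈ v → b ∈ y) ∧ Eqv u v ∧ (u ≠ x → v ≠ y) := by
  obtain ⟨R, hR, h1, h2, h3⟩ := h
  obtain ⟨v, hv⟩ := SD.exists_set (R := fun b => b ∈ y ∧ ∃ a, a ∈ u ∧ R a b) 0
    (.and (.mem .var0 (.const y)) (.ex (.and (.mem .var0 (.const u)) (.rel hR .var0 .var1))))
  refine ⟨v, fun b hb => ((hv b).1 hb).1, ⟨R, hR, ?_, ?_, ?_⟩, ?_⟩
  · intro a ha
    obtain ⟨b, hb, e⟩ := h1 a (hu a ha)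
    exact ⟨b, (hv b).2 ⟨hb, a, ha, e⟩, e⟩
  · exact fun b hb => ((hv b).1 hb).2
  · exact fun a ha a' ha' b hb b' hb' =>
      h3 a (hu a ha) a' (hu a' ha') b ((hv b).1 hb).1 b' ((hv b').1 hb').1
  · rintro hne rfl
    refine hne (Model.ext _ _ fun a => ⟨hu a, fun ha => ?_⟩)
    obtain ⟨b, hb, e⟩ := h1 a ha
    obtain ⟨-, a', ha', e'⟩ := (hv b).1 hb
    rwa [(h3 a ha a' (hu a' ha') b hb b hb e e').2 rfl]

theorem Eqv.ins {d w : M} (h : Eqv x y) (hw : w ∉ x) (hd : d ∉ y) :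
    Eqv (ins x w) (ins y d) := by
  obtain ⟨R, hR, h1, h2, h3⟩ := h
  refine ⟨fun a b => (a ∈ x ∧ b ∈ y ∧ R a b) ∨ (a = w ∧ b = d), SD.isRel (t := 0)
    (.or (.and (.mem .var1 (.const x)) (.and (.mem .var0 (.const y)) (.rel hR .var1 .var0)))
      (.and (.eq .var1 (.const w)) (.eq .var0 (.const d)))), ?_, ?_, ?_⟩
  · intro a ha
    rcases mem_ins.1 ha with ha | rfl
    · obtain ⟨b, hb, e⟩ := h1 a ha
      exact ⟨b, mem_ins.2 (Or.inl hb), Or.inl ⟨ha, hb, e⟩⟩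
    · exact ⟨d, mem_ins.2 (Or.inr rfl), Or.inr ⟨rfl, rfl⟩⟩
  · intro b hb
    rcases mem_ins.1 hb with hb | rfl
    · obtain ⟨a, ha, e⟩ := h2 b hb
      exact ⟨a, mem_ins.2 (Or.inl ha), Or.inl ⟨ha, hb, e⟩⟩
    · exact ⟨w, mem_ins.2 (Or.inr rfl), Or.inr ⟨rfl, rfl⟩⟩
  · rintro a - a' - b - b' - (⟨ha, hb, e⟩ | ⟨rfl, rfl⟩) (⟨ha', hb', e'⟩ | ⟨rfl, rfl⟩)
    · exact h3 a ha a' ha' b hb b' hb' e e'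
    · exact iff_of_false (fun e => hw (e ▸ ha)) fun e => hd (e ▸ hb)
    · exact iff_of_false (fun e => hw (e ▸ ha')) fun e => hd (e ▸ hb')
    · exact iff_of_true rfl rfl

/-- In the induction step the last adjoined `w` and its partner `d` are removed, which leaves a
bijection between the remainders. -/
theorem IsNat.mem_of_eqv {n : M} (hn : IsNat n) : ∀ x, x ∈ n → ∀ y, Eqv x y → y ∈ n := by
  refine hn.induction (P := fun n => ∀ x, x ∈ n → ∀ y, Eqv x y → y ∈ n) 0
    (.all (.imp (.mem .var0 .var1) (.all (.imp (.eqv .var1 .var0) (.mem .var0 .var2))))) ?_ ?_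
  · rintro z hz x hx y ⟨R, -, -, h2, -⟩
    refine (hz y).2 fun b hb => ?_
    obtain ⟨a, ha, -⟩ := h2 b hb
    exact (hz x).1 hx a ha
  · rintro n m - ih hm x hx y ⟨R, hR, h1, h2, h3⟩
    obtain ⟨u, hu, w, hw, rfl⟩ := (isSucc_iff.1 hm x).1 hx
    have hwi : w ∈ NF.ins u w := mem_ins.2 (Or.inr rfl)
    have hui : ∀ a ∈ u, a ∈ NF.ins u w := fun a ha => mem_ins.2 (Or.inl ha)
    obtain ⟨d, hd, e⟩ := h1 w hwi
    rw [← ins_rem hd]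
    refine hm.ins_mem (ih u hu _ ⟨R, hR, ?_, ?_, ?_⟩) fun h => (mem_rem.1 h).2 rfl
    · intro a ha
      obtain ⟨b, hb, e'⟩ := h1 a (hui a ha)
      refine ⟨b, mem_rem.2 ⟨hb, fun ebd => hw ?_⟩, e'⟩
      rwa [(h3 w hwi a (hui a ha) d hd b hb e e').2 ebd.symm]
    · intro b hb
      rw [mem_rem] at hb
      obtain ⟨a, ha, e'⟩ := h2 b hb.1
      refine ⟨a, (mem_ins.1 ha).resolve_right fun eaw => hb.2 ?_, e'⟩
      exact ((h3 w hwi a ha d hd b hb.1 e e').1 eaw.symm).symm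
    · exact fun a ha a' ha' b hb b' hb' =>
        h3 a (hui a ha) a' (hui a' ha') b (mem_rem.1 hb).1 b' (mem_rem.1 hb').1

/-! ### Singletons and power sets -/

theorem sing_inj {a b : M} : sing a = sing b ↔ a = b := ⟨sing_injective, fun h => h ▸ rfl⟩

theorem sing_mem_usc {a : M} : sing a ∈ usc x ↔ a ∈ x := by
  rw [mem_usc]
  exact ⟨fun ⟨b, hb, e⟩ => sing_injective e ▸ hb, fun h => ⟨a, h, rfl⟩⟩

theorem Tm.usc (hf : Tm c f (t + 1)) : Tm c (fun e => usc (f e)) (t + 2) := by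
  have key : ∀ x u : M, x = NF.usc u ↔ ∀ z, z ∈ x ↔ ∃ a, a ∈ u ∧ z = NF.sing a := fun x u =>
    ⟨fun h z => h ▸ mem_usc, fun h => Model.ext _ _ fun z => (h z).trans mem_usc.symm⟩
  refine ⟨?_⟩
  simp only [key]
  exact .all (.iff (.mem .var0 .var1) (.ex (.and (.mem .var0 hf.weaken.weaken.weaken)
    (.eq .var1 (.sing .var0)))))

theorem exists_eq_usc (h : ∀ a, a ∈ u → a ∈ usc x) : ∃ v, (∀ a, a ∈ v → a ∈ x) ∧ u = usc v := by
  obtain ⟨v, hv⟩ := SD.exists_set (R := fun a => sing a ∈ u) 0 (.mem (.sing .var0) (.const u))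
  refine ⟨v, fun a ha => sing_mem_usc.1 (h _ ((hv a).1 ha)), Model.ext _ _ fun s => ?_⟩
  rw [mem_usc]
  constructor
  · intro hs
    obtain ⟨a, -, rfl⟩ := mem_usc.1 (h s hs)
    exact ⟨a, (hv a).2 hs, rfl⟩
  · rintro ⟨a, ha, rfl⟩
    exact (hv a).1 ha

theorem exists_pow (x : M) : ∃ s : M, ∀ z, z ∈ s ↔ ∀ a, a ∈ z → a ∈ x :=
  SD.exists_set 1 (.all (.imp (.mem .var0 .var1) (.mem .var0 (.const x))))

/-- The power set of `x`. -/
noncomputable def pow (x : M) : M := (exists_pow x).choose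

theorem mem_pow : z ∈ pow x ↔ ∀ a, a ∈ z → a ∈ x := (exists_pow x).choose_spec z

theorem Tm.pow (hf : Tm c f (t + 1)) : Tm c (fun e => pow (f e)) (t + 2) := by
  have key : ∀ x u : M, x = NF.pow u ↔ ∀ z, z ∈ x ↔ ∀ a, a ∈ z → a ∈ u := fun x u =>
    ⟨fun h z => h ▸ mem_pow, fun h => Model.ext _ _ fun z => (h z).trans mem_pow.symm⟩
  refine ⟨?_⟩
  simp only [key]
  exact .all (.iff (.mem .var0 .var1) (.all (.imp (.mem .var0 .var1)
    (.mem .var0 hf.weaken.weaken.weaken))))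

theorem Eqv.usc (h : Eqv x y) : Eqv (usc x) (usc y) := by
  obtain ⟨R, hR, h1, h2, h3⟩ := h
  refine ⟨fun s s' => ∃ a b, R a b ∧ s = sing a ∧ s' = sing b, SD.isRel (t := 1)
    (.ex (.ex (.and (.rel hR .var1 .var0) (.and (.eq .var3 (.sing .var1))
      (.eq .var2 (.sing .var0)))))), ?_, ?_, ?_⟩
  · intro s hs
    obtain ⟨a, ha, rfl⟩ := mem_usc.1 hs
    obtain ⟨b, hb, e⟩ := h1 a ha
    exact ⟨_, sing_mem_usc.2 hb, a, b, e, rfl, rfl⟩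
  · intro s hs
    obtain ⟨b, hb, rfl⟩ := mem_usc.1 hs
    obtain ⟨a, ha, e⟩ := h2 b hb
    exact ⟨_, sing_mem_usc.2 ha, a, b, e, rfl, rfl⟩
  · rintro s hs s' hs' r hr r' hr' ⟨a, b, e, rfl, rfl⟩ ⟨a', b', e', rfl, rfl⟩
    rw [sing_mem_usc] at hs hs' hr hr'
    rw [sing_inj, sing_inj]
    exact h3 a hs a' hs' b hr b' hr' e e'

theorem Eqv.of_usc (h : Eqv (NF.usc x) (NF.usc y)) : Eqv x y := by
  obtain ⟨R, hR, h1, h2, h3⟩ := h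
  refine ⟨fun a b => R (sing a) (sing b), SD.isRel (t := 0) (.rel hR (.sing .var1) (.sing .var0)),
    ?_, ?_, ?_⟩
  · intro a ha
    obtain ⟨s, hs, e⟩ := h1 _ (sing_mem_usc.2 ha)
    obtain ⟨b, hb, rfl⟩ := mem_usc.1 hs
    exact ⟨b, hb, e⟩
  · intro b hb
    obtain ⟨s, hs, e⟩ := h2 _ (sing_mem_usc.2 hb)
    obtain ⟨a, ha, rfl⟩ := mem_usc.1 hs
    exact ⟨a, ha, e⟩
  · intro a ha a' ha' b hb b' hb' e e'
    simpa only [sing_inj] using h3 _ (sing_mem_usc.2 ha) _ (sing_mem_usc.2 ha') _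
      (sing_mem_usc.2 hb) _ (sing_mem_usc.2 hb') e e'

theorem Eqv.pow (h : Eqv x y) : Eqv (pow x) (pow y) := by
  obtain ⟨R, hR, h1, h2, h3⟩ := h
  -- Half of the injectivity of the image map `w ↦ v`; the other half is the same with `w` and `w'`
  -- exchanged.
  have key : ∀ w w' v v' : M, (∀ a, a ∈ w → a ∈ x) → (∀ a, a ∈ w' → a ∈ x) →
      (∀ b, b ∈ v ↔ b ∈ y ∧ ∃ a, a ∈ w ∧ R a b) → (∀ b, b ∈ v' ↔ b ∈ y ∧ ∃ a, a ∈ w' ∧ R a b) →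
      v = v' → ∀ a, a ∈ w → a ∈ w' := by
    rintro w w' v v' hw hw' hv hv' rfl a ha
    obtain ⟨b, hb, e⟩ := h1 a (hw a ha)
    obtain ⟨-, a', ha', e'⟩ := (hv' b).1 ((hv b).2 ⟨hb, a, ha, e⟩)
    rwa [(h3 a (hw a ha) a' (hw' a' ha') b hb b hb e e').2 rfl]
  refine ⟨fun w v => ∀ b, b ∈ v ↔ b ∈ y ∧ ∃ a, a ∈ w ∧ R a b, SD.isRel (t := 1)
    (.all (.iff (.mem .var0 .var1) (.and (.mem .var0 (.const y)) (.ex (.and (.mem .var0 .var3)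
      (.rel hR .var0 .var1)))))), ?_, ?_, ?_⟩
  · intro w hw
    obtain ⟨v, hv⟩ := SD.exists_set (R := fun b => b ∈ y ∧ ∃ a, a ∈ w ∧ R a b) 0
      (.and (.mem .var0 (.const y)) (.ex (.and (.mem .var0 (.const w)) (.rel hR .var0 .var1))))
    exact ⟨v, mem_pow.2 fun b hb => ((hv b).1 hb).1, hv⟩
  · intro v hv
    rw [mem_pow] at hv
    obtain ⟨w, hw⟩ := SD.exists_set (R := fun a => a ∈ x ∧ ∃ b, b ∈ v ∧ R a b) 0
      (.and (.mem .var0 (.const x)) (.ex (.and (.mem .var0 (.const v)) (.rel hR .var1 .var0))))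
    refine ⟨w, mem_pow.2 fun a ha => ((hw a).1 ha).1, fun b => ⟨fun hb => ?_, ?_⟩⟩
    · obtain ⟨a, ha, e⟩ := h2 b (hv b hb)
      exact ⟨hv b hb, a, (hw a).2 ⟨ha, b, hb, e⟩, e⟩
    · rintro ⟨hb, a, ha, e⟩
      obtain ⟨ha, b', hb', e'⟩ := (hw a).1 ha
      rwa [(h3 a ha a ha b hb b' (hv b' hb') e e').1 rfl]
  · intro w hw w' hw' v hv v' hv' e e'
    rw [mem_pow] at hw hw'
    constructor
    · rintro rfl
      exact Model.ext _ _ fun b => (e b).trans (e' b).symm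
    · intro ev
      exact Model.ext _ _ fun a => ⟨key w w' v v' hw hw' e e' ev a,
        key w' w v' v hw' hw e' e ev.symm a⟩

/-- The bijection is `{v} ↦ usc v`, stratified because both sides lie one type above `v`. -/
theorem eqv_usc_pow (x : M) : Eqv (usc (pow x)) (pow (usc x)) := by
  have hu : ∀ v w : M, usc v = usc w ↔ v = w := fun v w =>
    ⟨fun h => Model.ext _ _ fun a => by rw [← sing_mem_usc, h, sing_mem_usc], fun h => h ▸ rfl⟩
  refine ⟨fun s w => ∃ v, s = sing v ∧ w = usc v, SD.isRel (t := 2)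
    (.ex (.and (.eq .var2 (.sing .var0)) (.eq .var1 (.usc .var0)))), ?_, ?_, ?_⟩
  · intro s hs
    obtain ⟨v, hv, rfl⟩ := mem_usc.1 hs
    refine ⟨usc v, mem_pow.2 fun a ha => ?_, v, rfl, rfl⟩
    obtain ⟨b, hb, rfl⟩ := mem_usc.1 ha
    exact sing_mem_usc.2 (mem_pow.1 hv b hb)
  · intro w hw
    obtain ⟨v, hv, rfl⟩ := exists_eq_usc (mem_pow.1 hw)
    exact ⟨_, sing_mem_usc.2 (mem_pow.2 hv), v, rfl, rfl⟩
  · rintro s - s' - w - w' - ⟨v, rfl, rfl⟩ ⟨v', rfl, rfl⟩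
    rw [sing_inj, hu]

theorem empty_exists : ∃ s : M, ∀ z, z ∉ s := by
  obtain ⟨s, hs⟩ := SD.exists_set (M := M) (R := fun z => ¬ z = z) 0 (.neg (.eq .var0 .var0))
  exact ⟨s, fun z hz => (hs z).1 hz rfl⟩

theorem usc_subset_pow {s : M} (hs : s ∈ usc x) : s ∈ pow x := by
  obtain ⟨a, ha, rfl⟩ := mem_usc.1 hs
  exact mem_pow.2 fun b hb => mem_sing.1 hb ▸ ha

theorem usc_ne_pow (x : M) : usc x ≠ pow x := by
  intro h
  obtain ⟨s, hs⟩ := empty_exists (M := M)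
  have : s ∈ usc x := h ▸ mem_pow.2 fun a ha => (hs a ha).elim
  obtain ⟨a, -, rfl⟩ := mem_usc.1 this
  exact hs a (mem_sing.2 rfl)

end Equinumerosity

/-! ## The axiom of infinity -/

section Infinity

variable {M : Type u} [Model M] {Γ : Type u} {c : Ctx M Γ} {f g h : Γ → M} {t : ℕ}
  {x y z a b : M}

theorem exists_univ : ∃ s : M, ∀ z, z ∈ s := by
  obtain ⟨s, hs⟩ := SD.exists_set (M := M) (R := fun z => z = z) 0 (.eq .var0 .var0)
  exact ⟨s, fun z => (hs z).2 rfl⟩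

variable (M) in
/-- The universal set. -/
noncomputable def univ : M := exists_univ.choose

theorem mem_univ (z : M) : z ∈ univ M := exists_univ.choose_spec z

theorem eq_univ_iff : x = univ M ↔ ∀ z, z ∈ x :=
  ⟨fun h z => h ▸ mem_univ z, fun h => Model.ext _ _ fun z => iff_of_true (h z) (mem_univ z)⟩

theorem pow_univ : pow (univ M) = univ M :=
  eq_univ_iff.2 fun _ => mem_pow.2 fun a _ => mem_univ a

variable (M) in
/-- The universe is finite. -/
def FiniteUniv : Prop := ∃ n : M, IsNat n ∧ univ M ∈ n

theorem FiniteUniv.induction (hM : FiniteUniv M) {P : M → Prop} (t : ℕ)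
    (hP : SD ((Ctx.nil (M := M)).cons (t + 1)) (fun e => P e.2))
    (h : ∀ x, (∀ y, (∀ z, z ∈ y → z ∈ x) → y ≠ x → P y) → P x) (x : M) : P x := by
  obtain ⟨n, hn, hu⟩ := hM
  exact hn.strong_induction t hP h _ hu x fun z _ => mem_univ z

theorem rem_subset (x y : M) : ∀ z, z ∈ rem x y → z ∈ x := fun _ hz => (mem_rem.1 hz).1

theorem rem_ne (h : y ∈ x) : rem x y ≠ x := fun e => (mem_rem.1 (e.symm ▸ h : y ∈ rem x y)).2 rfl

theorem not_mem_rem (x y : M) : y ∉ rem x y := fun h => (mem_rem.1 h).2 rfl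

theorem FiniteUniv.exists_nat (hM : FiniteUniv M) (x : M) : ∃ n : M, IsNat n ∧ x ∈ n := by
  refine hM.induction (P := fun x => ∃ n, IsNat n ∧ x ∈ n) 0
    (.ex (.and (.isNat .var0) (.mem .var1 .var0))) (fun x ih => ?_) x
  by_cases hx : ∃ y, y ∈ x
  · obtain ⟨y, hy⟩ := hx
    obtain ⟨n, hn, h⟩ := ih _ (rem_subset x y) (rem_ne hy)
    obtain ⟨m, hm⟩ := exists_succ n
    exact ⟨m, hn.succ hm, ins_rem hy ▸ hm.ins_mem h (not_mem_rem x y)⟩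
  · obtain ⟨z, hz⟩ := exists_zero (M := M)
    exact ⟨z, hz.isNat, (hz x).2 fun y hy => hx ⟨y, hy⟩⟩

/-- A finite set is not equinumerous with a proper subset. -/
theorem FiniteUniv.eq_of_eqv (hM : FiniteUniv M) (h : Eqv x y) (hs : ∀ z, z ∈ y → z ∈ x) :
    y = x := by
  obtain ⟨n, hn, hx⟩ := hM.exists_nat x
  exact hn.eq_of_subset x hx y (hn.mem_of_eqv x hx y h) hs

/-- Induction on `x` with one `w` removed: an embedding of the rest into `y` either misses some `d`,
which becomes the image of `w`, or is onto `y`, so that the rest is the required proper subset. -/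
theorem FiniteUniv.comparable (hM : FiniteUniv M) (x y : M) :
    (∃ v, (∀ z, z ∈ v → z ∈ y) ∧ Eqv x v) ∨ ∃ u, (∀ z, z ∈ u → z ∈ x) ∧ u ≠ x ∧ Eqv u y := by
  refine hM.induction (P := fun x => (∃ v, (∀ z, z ∈ v → z ∈ y) ∧ Eqv x v) ∨
    ∃ u, (∀ z, z ∈ u → z ∈ x) ∧ u ≠ x ∧ Eqv u y) 0
    (.or (.ex (.and (.all (.imp (.mem .var0 .var1) (.mem .var0 (.const y)))) (.eqv .var1 .var0)))
      (.ex (.and (.all (.imp (.mem .var0 .var1) (.mem .var0 .var2)))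
        (.and (.neg (.eq .var0 .var1)) (.eqv .var0 (.const y)))))) (fun x ih => ?_) x
  by_cases hx : ∃ w, w ∈ x
  · obtain ⟨w, hw⟩ := hx
    rcases ih _ (rem_subset x w) (rem_ne hw) with ⟨v, hv, e⟩ | ⟨u, hu, -, e⟩
    · by_cases hvy : v = y
      · exact Or.inr ⟨_, rem_subset x w, rem_ne hw, hvy ▸ e⟩
      · obtain ⟨d, hd, hdv⟩ : ∃ d, d ∈ y ∧ d ∉ v := by
          by_contra hc
          push Not at hc
          exact hvy (Model.ext _ _ fun z => ⟨hv z, hc z⟩)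
        refine Or.inl ⟨ins v d, fun z hz => ?_, ins_rem hw ▸ e.ins (not_mem_rem x w) hdv⟩
        rcases mem_ins.1 hz with hz | rfl
        · exact hv z hz
        · exact hd
    · exact Or.inr ⟨u, fun z hz => rem_subset x w z (hu z hz),
        fun eu => not_mem_rem x w (hu w (eu ▸ hw)), e⟩
  · exact Or.inl ⟨x, fun z hz => (hx ⟨z, hz⟩).elim, .refl x⟩

/-- The cardinality of `b` is two to the cardinality of `a`. -/
def IsExp (a b : M) : Prop := ∃ x, Eqv a (usc x) ∧ Eqv b (pow x)

/-- Using `usc x` for the exponent brings it to the type of `pow x`; the relation is thus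
homogeneous and can be iterated inside stratified formulas. -/
theorem SD.isExp (hf : Tm c f (t + 2)) (hg : Tm c g (t + 2)) :
    SD c (fun e => IsExp (f e) (g e)) :=
  .ex (.and (.eqv hf.weaken (.usc .var0)) (.eqv hg.weaken (.pow (t := t) .var0)))

theorem isExp_usc_pow (x : M) : IsExp (usc x) (pow x) := ⟨x, .refl _, .refl _⟩

theorem IsExp.congr_right {b' : M} (h : IsExp a b) (e : Eqv b b') : IsExp a b' := by
  obtain ⟨x, h1, h2⟩ := h
  exact ⟨x, h1, e.symm.trans h2⟩

theorem IsExp.usc (h : IsExp a b) : IsExp (usc a) (usc b) := by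
  obtain ⟨x, h1, h2⟩ := h
  exact ⟨NF.usc x, h1.usc, h2.usc.trans (eqv_usc_pow x)⟩

/-- Since `usc x` is a proper subset of `pow x`, a predecessor of `b` is equinumerous with a proper
subset of `b`; induction along inclusion applies once the claim is made for all sets equinumerous
with the given one. -/
theorem FiniteUniv.isExp_induction (hM : FiniteUniv M) {P : M → Prop} (t : ℕ)
    (hP : SD ((Ctx.nil (M := M)).cons (t + 1)) (fun e => P e.2))
    (h : ∀ b, (∀ a, IsExp a b → P a) → P b) (b : M) : P b := by
  refine hM.induction (P := fun w => ∀ b, Eqv w b → P b) t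
    (.all (.imp (.eqv .var1 .var0) (.subst₁ hP .var0))) (fun w ih b e => h b ?_) b b (.refl b)
  rintro a ⟨x, h1, h2⟩
  obtain ⟨v, hv, e', hne⟩ := (h2.symm.trans e.symm).exists_subset (u := NF.usc x)
    fun s hs => usc_subset_pow hs
  exact ih v hv (hne (usc_ne_pow x)) a (e'.symm.trans h1.symm)

/-- Write `a ~ usc z` and `usc x ~ pow z`. If `z` embeds in `usc V`, then `z ~ usc w` and `usc`
cancels. Otherwise `usc V` is equinumerous with a proper subset `u` of `z`; then `pow u ~ usc V`
corresponds to a proper subset of `usc x ⊆ usc V`, which finiteness forbids. -/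
theorem FiniteUniv.isExp_usc (hM : FiniteUniv M) (h : IsExp a (usc x)) :
    ∃ w, Eqv a (usc (usc w)) ∧ Eqv x (pow w) := by
  obtain ⟨z, h1, h2⟩ := h
  rcases hM.comparable z (usc (univ M)) with ⟨v, hv, e⟩ | ⟨u, hu, hne, e⟩
  · obtain ⟨w, -, rfl⟩ := exists_eq_usc hv
    exact ⟨w, h1.trans e.usc, (h2.trans (e.pow.trans (eqv_usc_pow w).symm)).of_usc⟩
  · exfalso
    obtain ⟨v, hv, e', hne'⟩ := h2.symm.exists_subset (u := pow u)
      fun s hs => mem_pow.2 fun r hr => hu r (mem_pow.1 hs r hr)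
    have e1 : Eqv (usc (univ M)) v := by
      have := (eqv_usc_pow (univ M)).trans (e.symm.pow.trans e')
      rwa [pow_univ] at this
    have hsub : ∀ s, s ∈ usc x → s ∈ usc (univ M) := fun s hs => by
      obtain ⟨r, -, rfl⟩ := mem_usc.1 hs
      exact sing_mem_usc.2 (mem_univ r)
    have hv' := hM.eq_of_eqv e1 fun s hs => hsub s (hv s hs)
    refine hne' (fun ep => hne ?_) (Model.ext _ _ fun s => ⟨hv s, fun hs => hv' ▸ hsub s hs⟩)
    have hz : z ∈ pow u := ep ▸ mem_pow.2 fun _ h => h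
    exact Model.ext _ _ fun s => ⟨hu s, mem_pow.1 hz s⟩

/-- The kernel of the relation `IsExp`. -/
theorem FiniteUniv.exists_kernel (hM : FiniteUniv M) :
    ∃ L : M, ∀ b, b ∈ L ↔ ∀ a, IsExp a b → a ∉ L := by
  -- The kernel condition is not monotone in `L`, but applied twice it is: each predecessor of `b`
  -- has itself a predecessor in `L`. `L` is the least fixed point of the doubled condition.
  obtain ⟨L, hL⟩ := SD.exists_set (M := M)
    (R := fun b => ∀ X, (∀ b, (∀ a, IsExp a b → ∃ d, d ∈ X ∧ IsExp d a) → b ∈ X) → b ∈ X) 2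
    (.all (.imp (.all (.imp (.all (.imp (.isExp .var0 .var1) (.ex (.and (.mem .var0 .var3)
      (.isExp .var0 .var1))))) (.mem .var0 .var1))) (.mem .var1 .var0)))
  have closed : ∀ b, (∀ a, IsExp a b → ∃ d, d ∈ L ∧ IsExp d a) → b ∈ L := by
    refine fun b hb => (hL b).2 fun X hX => hX b fun a ha => ?_
    obtain ⟨d, hd, e⟩ := hb a ha
    exact ⟨d, (hL d).1 hd X hX, e⟩
  have unfolds : ∀ b, b ∈ L → ∀ a, IsExp a b → ∃ d, d ∈ L ∧ IsExp d a := by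
    obtain ⟨X, hX⟩ := SD.exists_set (M := M)
      (R := fun b => ∀ a, IsExp a b → ∃ d, d ∈ L ∧ IsExp d a) 2
      (.all (.imp (.isExp .var0 .var1) (.ex (.and (.mem .var0 (.const L)) (.isExp .var0 .var1)))))
    refine fun b hb => (hX b).1 ((hL b).1 hb X fun b hb => (hX b).2 fun a ha => ?_)
    obtain ⟨d, hd, e⟩ := hb a ha
    exact ⟨d, closed d ((hX d).1 hd), e⟩
  -- Well-foundedness reduces the doubled condition to the single one.
  have key : ∀ b, (b ∉ L ↔ ∃ a, a ∈ L ∧ IsExp a b) := by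
    refine hM.isExp_induction (P := fun b => (b ∉ L ↔ ∃ a, a ∈ L ∧ IsExp a b)) 1
      (.iff (.neg (.mem .var0 (.const L))) (.ex (.and (.mem .var0 (.const L))
        (.isExp (t := 0) .var0 .var1)))) fun b ih => ?_
    constructor
    · intro hb
      by_contra hc
      exact hb (closed b fun a ha => (ih a ha).1 fun haL => hc ⟨a, haL, ha⟩)
    · rintro ⟨a, haL, ha⟩ hb
      exact (ih a ha).2 (unfolds b hb a ha) haL
  refine ⟨L, fun b => ?_⟩
  rw [← not_iff_not, key b]
  push Not
  exact ⟨fun ⟨a, h1, h2⟩ => ⟨a, h2, h1⟩, fun ⟨a, h1, h2⟩ => ⟨a, h2, h1⟩⟩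

/-- The axiom of infinity holds in a model of NF. -/
theorem not_finiteUniv : ¬ FiniteUniv M := by
  intro hM
  obtain ⟨L, hL⟩ := hM.exists_kernel
  have congr : ∀ a b, Eqv a b → a ∈ L → b ∈ L := fun a b e ha =>
    (hL b).2 fun d hd => (hL a).1 ha d (hd.congr_right e.symm)
  -- Up to equinumerosity, the predecessors of `usc x` are the sets `usc a` with `a` a predecessor
  -- of `x`.
  have T_inv : ∀ x, (x ∈ L ↔ usc x ∈ L) := by
    refine hM.isExp_induction (P := fun x => (x ∈ L ↔ usc x ∈ L)) 2
      (.iff (.mem .var0 (.const L)) (.mem (.usc .var0) (.const L))) fun x ih => ?_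
    constructor
    · refine fun hx => (hL _).2 fun a ha haL => ?_
      obtain ⟨w, e1, e2⟩ := hM.isExp_usc ha
      have hw : IsExp (usc w) x := (isExp_usc_pow w).congr_right e2.symm
      exact (hL x).1 hx _ hw ((ih _ hw).2 (congr _ _ e1 haL))
    · exact fun hx => (hL _).2 fun a ha haL => (hL _).1 hx _ ha.usc ((ih a ha).1 haL)
  have hexp : IsExp (usc (univ M)) (univ M) := by
    have := isExp_usc_pow (univ M)
    rwa [pow_univ] at this
  -- If `pow x` is equinumerous with the universe, finiteness makes it the universe, so `x` is the
  -- universe too.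
  have huniv : univ M ∈ L ↔ usc (univ M) ∉ L := by
    refine ⟨fun h => (hL _).1 h _ hexp, fun h => (hL _).2 ?_⟩
    rintro a ⟨x, h1, h2⟩ haL
    have hp := hM.eq_of_eqv h2 fun z _ => mem_univ z
    have hx : x = univ M := eq_univ_iff.2 fun z =>
      mem_pow.1 (hp.symm ▸ mem_univ _ : univ M ∈ pow x) z (mem_univ z)
    exact h (congr _ _ (hx ▸ h1) haL)
  have := T_inv (univ M)
  tauto

/-- Here infinity enters: a member of a numeral to which nothing can be adjoined would be the
universe. -/
theorem IsNat.exists_mem {n : M} (hn : IsNat n) : ∃ x, x ∈ n := by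
  refine hn.induction (P := fun n => ∃ x, x ∈ n) 1 (.ex (.mem .var0 .var1)) ?_ ?_
  · intro z hz
    obtain ⟨s, hs⟩ := empty_exists (M := M)
    exact ⟨s, (hz s).2 hs⟩
  · rintro n m hn ⟨x, hx⟩ hm
    by_cases h : ∃ y, y ∉ x
    · obtain ⟨y, hy⟩ := h
      exact ⟨_, hm.ins_mem hx hy⟩
    · push Not at h
      exact (not_finiteUniv ⟨n, hn, eq_univ_iff.2 h ▸ hx⟩).elim

theorem IsSucc.inj {n n' m : M} (hn : IsNat n) (hn' : IsNat n') (h : IsSucc n m)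
    (h' : IsSucc n' m) : n = n' := by
  obtain ⟨x, hx⟩ := (hn.succ h).exists_mem
  obtain ⟨y, hy⟩ := h.nonempty hx
  exact hn.eq_of_mem n' hn' _ (hn.rem_mem m h x hx y hy) (hn'.rem_mem m h' x hx y hy)

/-! ## Type-level pairs -/

theorem SD.isIncr (hf : Tm c f (t + 2)) (hg : Tm c g (t + 2)) :
    SD c (fun e => IsIncr (f e) (g e)) :=
  .or (.and (.isNat hf) (.isSucc hf hg)) (.and (.neg (.isNat hf)) (.eq hg hf))

theorem exists_isIncr (y : M) : ∃ w, IsIncr y w := by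
  by_cases h : IsNat y
  · obtain ⟨m, hm⟩ := exists_succ y
    exact ⟨m, Or.inl ⟨h, hm⟩⟩
  · exact ⟨y, Or.inr ⟨h, rfl⟩⟩

theorem IsIncr.inj {y y' w : M} (h : IsIncr y w) (h' : IsIncr y' w) : y = y' := by
  rcases h with ⟨h1, h2⟩ | ⟨h1, rfl⟩
  · rcases h' with ⟨h1', h2'⟩ | ⟨h1', rfl⟩
    · exact h2.inj h1 h1' h2'
    · exact (h1' (h1.succ h2)).elim
  · rcases h' with ⟨h1', h2'⟩ | ⟨h1', rfl⟩
    · exact (h1 (h1'.succ h2')).elim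
    · rfl

theorem IsIncr.not_isZero {y w : M} (h : IsIncr y w) : ¬ IsZero w := by
  rcases h with ⟨-, h⟩ | ⟨h, rfl⟩
  · exact h.not_isZero
  · exact fun h0 => h h0.isNat

theorem SD.isPhi (hf : Tm c f (t + 3)) (hg : Tm c g (t + 3)) : SD c (fun e => IsPhi (f e) (g e)) := by
  unfold IsPhi
  exact .all (.iff (.mem .var0 hg.weaken) (.ex (.and (.mem .var0 hf.weaken.weaken)
    (.isIncr .var0 .var1))))

theorem exists_isPhi (x : M) : ∃ u, IsPhi x u :=
  SD.exists_set 2 (.ex (.and (.mem .var0 (.const x)) (.isIncr .var0 .var1)))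

theorem IsPhi.inj {x x' u : M} (h : IsPhi x u) (h' : IsPhi x' u) : x = x' := by
  have key : ∀ {x x' : M}, IsPhi x u → IsPhi x' u → ∀ y, y ∈ x → y ∈ x' := by
    intro x x' h h' y hy
    obtain ⟨w, hw⟩ := exists_isIncr y
    obtain ⟨y', hy', hw'⟩ := (h' w).1 ((h w).2 ⟨y, hy, hw⟩)
    rwa [hw.inj hw']
  exact Model.ext _ _ fun y => ⟨key h h' y, key h' h y⟩

theorem IsPhi.not_isZero_mem {x u z : M} (h : IsPhi x u) (hz : z ∈ u) : ¬ IsZero z := by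
  obtain ⟨y, -, hy⟩ := (h z).1 hz
  exact hy.not_isZero

/-- Numerals have type `t + 2`, the sets `φ` acts on have type `t + 3`, and so the components and
the pair share the type `t + 4`. -/
theorem SD.isPair (hf : Tm c f (t + 4)) (hg : Tm c g (t + 4)) (hh : Tm c h (t + 4)) :
    SD c (fun e => IsPair (f e) (g e) (h e)) := by
  unfold IsPair
  exact .all (.iff (.mem .var0 hh.weaken) (.or
    (.ex (.and (.mem .var0 hf.weaken.weaken) (.isPhi .var0 .var1)))
    (.ex (.and (.mem .var0 hg.weaken.weaken) (.ex (.and (.isPhi .var1 .var0)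
      (.all (.iff (.mem .var0 .var3) (.or (.mem .var0 .var1) (.isZero .var0))))))))))

theorem exists_isPair (a b : M) : ∃ p, IsPair a b p :=
  SD.exists_set 3 (.or (.ex (.and (.mem .var0 (.const a)) (.isPhi .var0 .var1)))
    (.ex (.and (.mem .var0 (.const b)) (.ex (.and (.isPhi .var1 .var0)
      (.all (.iff (.mem .var0 .var3) (.or (.mem .var0 .var1) (.isZero .var0)))))))))

theorem IsPair.unique {p q : M} (h : IsPair a b p) (h' : IsPair a b q) : p = q :=
  Model.ext _ _ fun w => (h w).trans (h' w).symm

/-- Zero is never a value of the increment, so a member of `p` comes from the second component iff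
it contains zero; after deleting zero, injectivity of `φ` recovers the original element. -/
theorem IsPair.inj {a' b' p : M} (h : IsPair a b p) (h' : IsPair a' b' p) : a = a' ∧ b = b' := by
  obtain ⟨z, hz⟩ := exists_zero (M := M)
  have left : ∀ {a a' b b' : M}, IsPair a b p → IsPair a' b' p → ∀ x, x ∈ a → x ∈ a' := by
    intro a a' b b' h h' x hx
    obtain ⟨w, hw⟩ := exists_isPhi x
    rcases (h' w).1 ((h w).2 (Or.inl ⟨x, hx, hw⟩)) with ⟨x', hx', hw'⟩ | ⟨y, -, v, -, hv⟩
    · rwa [hw.inj hw']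
    · exact (hw.not_isZero_mem ((hv z).2 (Or.inr hz)) hz).elim
  have right : ∀ {a a' b b' : M}, IsPair a b p → IsPair a' b' p → ∀ y, y ∈ b → y ∈ b' := by
    intro a a' b b' h h' y hy
    obtain ⟨v, hv⟩ := exists_isPhi y
    have hi : ∀ t, t ∈ NF.ins v z ↔ t ∈ v ∨ IsZero t := fun t => mem_ins.trans
      (or_congr_right ⟨fun e => e ▸ hz, fun e => e.unique hz⟩)
    rcases (h' (NF.ins v z)).1 ((h _).2 (Or.inr ⟨y, hy, v, hv, hi⟩)) with
      ⟨x', -, hw'⟩ | ⟨y', hy', v', hv', hi'⟩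
    · exact (hw'.not_isZero_mem (mem_ins.2 (Or.inr rfl)) hz).elim
    · have : v = v' := Model.ext _ _ fun t => by
        have := (hi t).symm.trans (hi' t)
        constructor
        · exact fun ht => (this.1 (Or.inl ht)).resolve_right (hv.not_isZero_mem ht)
        · exact fun ht => (this.2 (Or.inl ht)).resolve_right (hv'.not_isZero_mem ht)
      rwa [hv.inj (this ▸ hv')]
  exact ⟨Model.ext _ _ fun x => ⟨left h h' x, left h' h x⟩,
    Model.ext _ _ fun y => ⟨right h h' y, right h' h y⟩⟩

/-- The type-level ordered pair. -/
noncomputable def qpair (a b : M) : M := (exists_isPair a b).choose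

theorem isPair_qpair (a b : M) : IsPair a b (qpair a b) := (exists_isPair a b).choose_spec

theorem isPair_iff {p : M} : IsPair a b p ↔ p = qpair a b :=
  ⟨fun h => h.unique (isPair_qpair a b), fun h => h ▸ isPair_qpair a b⟩

theorem qpair_inj {a' b' : M} (h : qpair a b = qpair a' b') : a = a' ∧ b = b' :=
  (isPair_qpair a b).inj (h ▸ isPair_qpair a' b')

theorem Tm.qpair (hf : Tm c f (t + 4)) (hg : Tm c g (t + 4)) :
    Tm c (fun e => qpair (f e) (g e)) (t + 4) := by
  refine ⟨?_⟩
  simp only [← isPair_iff]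
  exact .isPair hf.weaken hg.weaken .var0

end Infinity

/-! ## Morphisms from definable relations -/

section Morphisms

variable {M : Type u} [Model M] {A B C D : NFSet M}

/-- The morphism `f` takes the value `y` at `x`. -/
def App (f : A ⟶ B) (x y : M) : Prop := ∃ hx : x ∈ A.carrier, (app f ⟨x, hx⟩).1 = y

theorem app_iff {f : A ⟶ B} {x : A.Elem} {y : B.Elem} : App f x.1 y.1 ↔ app f x = y :=
  ⟨fun ⟨_, h⟩ => Subtype.ext h, fun h => ⟨x.2, congrArg Subtype.val h⟩⟩

theorem App.self (f : A ⟶ B) (x : A.Elem) : App f x.1 (app f x).1 := app_iff.2 rfl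

theorem App.elems {f : A ⟶ B} {x y : M} (h : App f x y) :
    ∃ (a : A.Elem) (b : B.Elem), a.1 = x ∧ b.1 = y ∧ app f a = b :=
  ⟨⟨x, h.1⟩, _, rfl, h.2, rfl⟩

theorem App.unique {f : A ⟶ B} {x y y' : M} (h : App f x y) (h' : App f x y') : y = y' :=
  h.2.symm.trans h'.2

theorem isRel_app (f : A ⟶ B) : IsRel (App f) := by
  obtain ⟨G, hG⟩ := NFSet.Hom.graph f
  refine ⟨G, fun a b => ⟨?_, ?_⟩⟩
  · rintro ⟨ha, rfl⟩
    obtain ⟨p, hp⟩ := exists_kpair a (app f ⟨a, ha⟩).1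
    exact ⟨p, hp, (hG p).2 ⟨⟨a, ha⟩, hp⟩⟩
  · rintro ⟨p, hp, h⟩
    obtain ⟨x, hx⟩ := (hG p).1 h
    obtain ⟨rfl, rfl⟩ := hp.inj hx
    exact App.self f x

theorem SD.app {Γ : Type u} {c : Ctx M Γ} {a b : Γ → M} {t : ℕ} (f : A ⟶ B) (ha : Tm c a t)
    (hb : Tm c b t) : SD c (fun e => App f (a e) (b e)) :=
  .rel (isRel_app f) ha hb

/-- A definable functional relation gives a morphism. -/
theorem exists_hom (A B : NFSet M) (R : M → M → Prop) (t : ℕ)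
    (hR : SD (((Ctx.nil (M := M)).cons t).cons t) (fun e => R e.1.2 e.2))
    (h : ∀ x : A.Elem, ∃ y : B.Elem, R x.1 y.1)
    (hu : ∀ (x : A.Elem) (y y' : B.Elem), R x.1 y.1 → R x.1 y'.1 → y = y') :
    ∃ f : A ⟶ B, ∀ x, R x.1 (NF.app f x).1 := by
  choose F hF using h
  obtain ⟨G, hG⟩ := SD.exists_graph (R := fun a b => a ∈ A.carrier ∧ b ∈ B.carrier ∧ R a b)
    (t := t) (.and (.mem .var1 (.const _)) (.and (.mem .var0 (.const _)) (.subst₂ hR .var1 .var0)))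
  refine ⟨NFSet.Hom.mk F ⟨G, fun p => (hG p).trans ⟨?_, ?_⟩⟩, hF⟩
  · rintro ⟨a, b, hp, ha, hb, h⟩
    obtain rfl := congrArg Subtype.val (hu ⟨a, ha⟩ ⟨b, hb⟩ _ h (hF _))
    exact ⟨⟨a, ha⟩, hp⟩
  · rintro ⟨x, hx⟩
    exact ⟨_, _, hx, x.2, (F x).2, hF x⟩

theorem exists_const (A : NFSet M) (b : B.Elem) : ∃ f : A ⟶ B, ∀ x, app f x = b := by
  obtain ⟨f, hf⟩ := exists_hom A B (fun _ y => y = b.1) 0 (.eq .var0 (.const _))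
    (fun _ => ⟨b, rfl⟩) fun _ y y' h h' => Subtype.ext (h.trans h'.symm)
  exact ⟨f, fun x => Subtype.ext (hf x)⟩

/-! ## Pullbacks -/

/-- The usual set of pairs. The pairs are type-level, so the projections and the induced map relate
objects of one type, as `exists_hom` requires. -/
theorem hasPullback (f : A ⟶ C) (g : B ⟶ C) : HasLimit (cospan f g) := by
  obtain ⟨P, hP⟩ := SD.exists_set
    (R := fun p => ∃ a b c, App f a c ∧ App g b c ∧ p = qpair a b) 4
    (.ex (.ex (.ex (.and (.app f .var2 .var0) (.and (.app g .var1 .var0)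
      (.eq .var3 (.qpair .var2 .var1)))))))
  have elems : ∀ p : NFSet.Elem (M := M) ⟨P⟩, ∃ (a : A.Elem) (b : B.Elem),
      app f a = app g b ∧ p.1 = qpair a.1 b.1 := by
    rintro ⟨p, hp⟩
    obtain ⟨a, b, c, ha, hb, rfl⟩ := (hP p).1 hp
    obtain ⟨a, c, rfl, rfl, ea⟩ := ha.elems
    obtain ⟨b, c', rfl, hc, eb⟩ := hb.elems
    exact ⟨a, b, ea.trans ((Subtype.ext hc.symm).trans eb.symm), rfl⟩
  have mem : ∀ (a : A.Elem) (b : B.Elem), app f a = app g b → qpair a.1 b.1 ∈ P := fun a b h =>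
    (hP _).2 ⟨a.1, b.1, _, App.self f a, h ▸ App.self g b, rfl⟩
  obtain ⟨p₁, h₁⟩ := exists_hom ⟨P⟩ A (fun p a => ∃ b, p = qpair a b) 4
    (.ex (.eq .var2 (.qpair .var1 .var0)))
    (fun p => by
      obtain ⟨a, b, -, e⟩ := elems p
      exact ⟨a, b.1, e⟩)
    (fun p a a' ⟨b, e⟩ ⟨b', e'⟩ => Subtype.ext (qpair_inj (e.symm.trans e')).1)
  obtain ⟨p₂, h₂⟩ := exists_hom ⟨P⟩ B (fun p b => ∃ a, p = qpair a b) 4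
    (.ex (.eq .var2 (.qpair .var0 .var1)))
    (fun p => by
      obtain ⟨a, b, -, e⟩ := elems p
      exact ⟨b, a.1, e⟩)
    (fun p b b' ⟨a, e⟩ ⟨a', e'⟩ => Subtype.ext (qpair_inj (e.symm.trans e')).2)
  have val : ∀ p, p.1 = qpair (app p₁ p).1 (app p₂ p).1 := fun p => by
    obtain ⟨b, e⟩ := h₁ p
    obtain ⟨a, e'⟩ := h₂ p
    rw [(qpair_inj (e.symm.trans e')).2] at e
    exact e
  have proj : ∀ p (a : A.Elem) (b : B.Elem), p.1 = qpair a.1 b.1 → app p₁ p = a ∧ app p₂ p = b :=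
    fun p a b e => by
      obtain ⟨e₁, e₂⟩ := qpair_inj ((val p).symm.trans e)
      exact ⟨Subtype.ext e₁, Subtype.ext e₂⟩
  have w : p₁ ≫ f = p₂ ≫ g := hom_ext fun p => by
    obtain ⟨a, b, h, e⟩ := elems p
    obtain ⟨e₁, e₂⟩ := proj p a b e
    simp only [app_comp, e₁, e₂, h]
  refine HasLimit.mk ⟨PullbackCone.mk p₁ p₂ w, PullbackCone.isLimitAux' _ fun s => ?_⟩
  have hs : ∀ x, app f (app s.fst x) = app g (app s.snd x) := fun x =>
    congrArg (fun k => app k x) s.condition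
  have hl := exists_hom s.pt ⟨P⟩
    (fun x p => ∃ a b, App s.fst x a ∧ App s.snd x b ∧ p = qpair a b) 4
    (.ex (.ex (.and (.app s.fst .var3 .var1) (.and (.app s.snd .var3 .var0)
      (.eq .var2 (.qpair .var1 .var0))))))
    (fun x => ⟨⟨_, mem _ _ (hs x)⟩, _, _, App.self _ _, App.self _ _, rfl⟩)
    (fun x p p' ⟨a, b, ha, hb, e⟩ ⟨a', b', ha', hb', e'⟩ => Subtype.ext <| by
      rw [e, e', ha.unique ha', hb.unique hb'])
  have hl' : ∃ l : s.pt ⟶ ⟨P⟩, ∀ x, (app l x).1 = qpair (app s.fst x).1 (app s.snd x).1 := by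
    obtain ⟨l, hl⟩ := hl
    refine ⟨l, fun x => ?_⟩
    obtain ⟨a, b, ha, hb, e⟩ := hl x
    rw [e, ha.unique (App.self _ _), hb.unique (App.self _ _)]
  refine ⟨hl'.choose, hom_ext fun x => (proj _ _ _ (hl'.choose_spec x)).1,
    hom_ext fun x => (proj _ _ _ (hl'.choose_spec x)).2, fun {m} h₁ h₂ => hom_ext fun x =>
      Subtype.ext ?_⟩
  refine (val (app m x)).trans ((congrArg₂ qpair ?_ ?_).trans (hl'.choose_spec x).symm)
  · rw [← h₁]
    rfl
  · rw [← h₂]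
    rfl

instance : HasPullbacks (NFSet M) :=
  have : ∀ {A B C : NFSet M} {f : A ⟶ C} {g : B ⟶ C}, HasLimit (cospan f g) := hasPullback _ _
  hasPullbacks_of_hasLimit_cospan _

/-- `pullback f g` is an unspecified limit, so its elements are reached through morphisms from a
one-element set. -/
theorem exists_pullback_elem (f : A ⟶ C) (g : B ⟶ C) {a : A.Elem} {b : B.Elem}
    (h : app f a = app g b) :
    ∃ x : (pullback f g).Elem, app (pullback.fst f g) x = a ∧ app (pullback.snd f g) x = b := by
  obtain ⟨i, hi⟩ := exists_const ⟨sing (univ M)⟩ a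
  obtain ⟨j, hj⟩ := exists_const ⟨sing (univ M)⟩ b
  have w : i ≫ f = j ≫ g := hom_ext fun x => by simp only [app_comp, hi, hj, h]
  let s : NFSet.Elem (M := M) ⟨sing (univ M)⟩ := ⟨univ M, mem_sing.2 rfl⟩
  refine ⟨app (pullback.lift i j w) s, ?_, ?_⟩
  · rw [← app_comp, pullback.lift_fst, hi]
  · rw [← app_comp, pullback.lift_snd, hj]

theorem pullback_elem_ext {f : A ⟶ C} {g : B ⟶ C} {x y : (pullback f g).Elem}
    (h₁ : app (pullback.fst f g) x = app (pullback.fst f g) y)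
    (h₂ : app (pullback.snd f g) x = app (pullback.snd f g) y) : x = y := by
  obtain ⟨i, hi⟩ := exists_const ⟨sing (univ M)⟩ x
  obtain ⟨j, hj⟩ := exists_const ⟨sing (univ M)⟩ y
  have : i = j := pullback.hom_ext (hom_ext fun s => by simp only [app_comp, hi, hj, h₁])
    (hom_ext fun s => by simp only [app_comp, hi, hj, h₂])
  rw [← hi ⟨univ M, mem_sing.2 rfl⟩, this, hj]

end Morphisms

/-! ## The pseudo dependent product -/

section Product

variable {M : Type u} [Model M] {A B : NFSet M} {f : A ⟶ B} {D D' : Over A}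

theorem FibreSection.isTagged_iff {b : B.Elem} {s : FibreSection f D b} {p : M} :
    s.IsTagged p ↔ ∃ g, s.IsGraph g ∧ p = qpair g (sing b.1) := by
  simp only [FibreSection.IsTagged, isPair_iff]

theorem FibreSection.isGraph_iff {b : B.Elem} {s : FibreSection f D b} {g : M} :
    s.IsGraph g ↔ ∀ p, p ∈ g ↔ ∃ (a : A.Elem) (ha : app f a = b),
      p = qpair a.1 (s.toFun a ha).1 := by
  simp only [FibreSection.IsGraph, isPair_iff]

theorem FibreSection.IsGraph.mem {b : B.Elem} {s : FibreSection f D b} {g : M} (h : s.IsGraph g)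
    (a : A.Elem) (ha : app f a = b) : qpair a.1 (s.toFun a ha).1 ∈ g :=
  (isGraph_iff.1 h _).2 ⟨a, ha, rfl⟩

theorem FibreSection.IsGraph.eq_of_mem {b : B.Elem} {s : FibreSection f D b} {g : M}
    (h : s.IsGraph g) {a d : M} (hg : qpair a d ∈ g) :
    ∃ (x : A.Elem) (hx : app f x = b), a = x.1 ∧ d = (s.toFun x hx).1 := by
  obtain ⟨x, hx, e⟩ := (isGraph_iff.1 h _).1 hg
  exact ⟨x, hx, qpair_inj e⟩

theorem FibreSection.IsGraph.unique {b : B.Elem} {s : FibreSection f D b} {g g' : M}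
    (h : s.IsGraph g) (h' : s.IsGraph g') : g = g' :=
  Model.ext _ _ fun p => (h p).trans (h' p).symm

theorem FibreSection.IsTagged.unique {b : B.Elem} {s : FibreSection f D b} {p q : M}
    (h : s.IsTagged p) (h' : s.IsTagged q) : p = q := by
  obtain ⟨g, hg, rfl⟩ := isTagged_iff.1 h
  obtain ⟨g', hg', rfl⟩ := isTagged_iff.1 h'
  rw [hg.unique hg']

theorem FibreSection.IsTagged.eq_of_tagged {b b' : B.Elem} {s : FibreSection f D b}
    {s' : FibreSection f D b'} {p : M} (h : s.IsTagged p) (h' : s'.IsTagged p) :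
    b = b' ∧ ∀ a ha ha', s.toFun a ha = s'.toFun a ha' := by
  obtain ⟨g, hg, rfl⟩ := isTagged_iff.1 h
  obtain ⟨g', hg', e⟩ := isTagged_iff.1 h'
  obtain ⟨rfl, eb⟩ := qpair_inj e
  refine ⟨Subtype.ext (sing_injective eb), fun a ha ha' => Subtype.ext ?_⟩
  obtain ⟨x, hx, e₁, e₂⟩ := hg'.eq_of_mem (hg.mem a ha)
  obtain rfl := Subtype.ext e₁
  exact e₂

theorem FibreSection.IsTagged.congr {b b' : B.Elem} {s : FibreSection f D b}
    {s' : FibreSection f D b'} {p : M} (h : s.IsTagged p) (hb : b = b')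
    (hs : ∀ a ha ha', s.toFun a ha = s'.toFun a ha') : s'.IsTagged p := by
  subst hb
  have : s = s' := by
    obtain ⟨t, ht⟩ := s
    obtain ⟨t', ht'⟩ := s'
    congr 1
    funext a ha
    exact hs a ha ha
  exact this ▸ h

variable (f D) in
-- With the elements of `A`, `B` and `D` at type 4, the graph `g` and `{b}` are both at type 5, and
-- so is their pair. The defining formula states internally that `g` is a function on the fibre and
-- a section.
theorem exists_piCarrier : ∃ P : M, ∀ p, p ∈ P ↔
    ∃ (b : B.Elem) (s : FibreSection f D b), s.IsTagged p := by
  obtain ⟨P, hP⟩ := SD.exists_set (R := fun p => ∃ b g, b ∈ B.carrier ∧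
    (∀ q, q ∈ g → ∃ a d, App f a b ∧ q = qpair a d) ∧
    (∀ a, App f a b → ∃ d, qpair a d ∈ g ∧ App (B := A) D.hom d a) ∧
    (∀ a d d', qpair a d ∈ g → qpair a d' ∈ g → d = d') ∧ p = qpair g (sing b)) 5
    (.ex (t := 4) (.ex (t := 5) (.and (.mem .var1 (.const _)) (.and
      (.all (.imp (.mem .var0 .var1) (.ex (.ex (.and (.app f .var1 .var4)
        (.eq .var2 (.qpair .var1 .var0))))))) (.and
      (.all (.imp (.app f .var0 .var2) (.ex (.and (.mem (.qpair .var1 .var0) .var2)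
        (.app (B := A) D.hom .var0 .var1))))) (.and
      (.all (.all (.all (.imp (.mem (.qpair .var2 .var1) .var3)
        (.imp (.mem (.qpair .var2 .var0) .var3) (.eq .var1 .var0))))))
      (.eq .var2 (.qpair .var0 (.sing .var1)))))))))
  refine ⟨P, fun p => (hP p).trans ⟨?_, ?_⟩⟩
  · rintro ⟨b, g, hb, h1, h2, h3, rfl⟩
    have h2' : ∀ (a : A.Elem), app f a = ⟨b, hb⟩ → ∃ d : D.left.Elem,
        qpair a.1 d.1 ∈ g ∧ app (B := A) D.hom d = a := by
      intro a ha
      obtain ⟨d, hd, h⟩ := h2 a.1 ((app_iff (y := ⟨b, hb⟩)).2 ha)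
      obtain ⟨d, a', rfl, e, h⟩ := h.elems
      exact ⟨d, hd, h.trans (Subtype.ext e)⟩
    choose F hF hF' using h2'
    refine ⟨⟨b, hb⟩, ⟨F, hF'⟩, FibreSection.isTagged_iff.2
      ⟨g, FibreSection.isGraph_iff.2 fun q => ⟨fun hq => ?_, ?_⟩, rfl⟩⟩
    · obtain ⟨a, d, ha, rfl⟩ := h1 q hq
      obtain ⟨a, b', rfl, rfl, ea⟩ := ha.elems
      exact ⟨a, ea, by rw [h3 _ _ _ hq (hF a ea)]⟩
    · rintro ⟨a, ha, rfl⟩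
      exact hF a ha
  · rintro ⟨b, s, hs⟩
    obtain ⟨g, hg, rfl⟩ := FibreSection.isTagged_iff.1 hs
    refine ⟨b.1, g, b.2, fun q hq => ?_, fun a ha => ?_, fun a d d' h h' => ?_, rfl⟩
    · obtain ⟨a, ha, rfl⟩ := (FibreSection.isGraph_iff.1 hg q).1 hq
      exact ⟨_, _, app_iff.2 ha, rfl⟩
    · obtain ⟨a, b', rfl, e, ea⟩ := ha.elems
      obtain rfl := Subtype.ext e
      exact ⟨_, hg.mem a ea, app_iff.2 (s.proj a ea)⟩
    · obtain ⟨x, hx, e, rfl⟩ := hg.eq_of_mem h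
      obtain ⟨x', hx', e', rfl⟩ := hg.eq_of_mem h'
      obtain rfl := Subtype.ext (e.symm.trans e')
      rfl

variable (f D) in
/-- The set of the pairs `⟨s, {b}⟩`. -/
noncomputable def piObj : NFSet M := ⟨(exists_piCarrier f D).choose⟩

theorem mem_piObj {p : M} : p ∈ (piObj f D).carrier ↔
    ∃ (b : B.Elem) (s : FibreSection f D b), s.IsTagged p :=
  (exists_piCarrier f D).choose_spec p

variable (f D) in
theorem exists_piHom : ∃ k : piObj f D ⟶ (T M).obj B, ∀ (p : (piObj f D).Elem) (b : B.Elem)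
    (s : FibreSection f D b), s.IsTagged p.1 → app (B := (T M).obj B) k p = singElem b := by
  obtain ⟨k, hk⟩ := exists_hom (piObj f D) ((T M).obj B)
    (fun p y => ∃ g b, p = qpair g (sing b) ∧ y = sing b) 5
    (.ex (.ex (t := 4) (.and (.eq .var3 (.qpair .var1 (.sing .var0))) (.eq .var2 (.sing .var0)))))
    (fun p => by
      obtain ⟨b, s, hs⟩ := mem_piObj.1 p.2
      obtain ⟨g, -, e⟩ := FibreSection.isTagged_iff.1 hs
      exact ⟨singElem b, g, b.1, e, rfl⟩)
    (by
      rintro p y y' ⟨g, b, e, h⟩ ⟨g', b', e', h'⟩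
      exact Subtype.ext (h.trans ((qpair_inj (e.symm.trans e')).2.trans h'.symm)))
  refine ⟨k, fun p b s hs => ?_⟩
  obtain ⟨g, b', e, h⟩ := hk p
  obtain ⟨g', -, e'⟩ := FibreSection.isTagged_iff.1 hs
  exact Subtype.ext (h.trans (qpair_inj (e.symm.trans e')).2)

variable (f D) in
/-- The projection `⟨s, {b}⟩ ↦ {b}`. -/
noncomputable def piHom : piObj f D ⟶ (T M).obj B := (exists_piHom f D).choose

theorem app_piHom {p : (piObj f D).Elem} {b : B.Elem} {s : FibreSection f D b}
    (hs : s.IsTagged p.1) : app (B := (T M).obj B) (piHom f D) p = singElem b :=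
  (exists_piHom f D).choose_spec p b s hs

/-- The composite of a section that is a set with a morphism is a set. -/
theorem FibreSection.IsGraph.comp {b : B.Elem} {s : FibreSection f D b} {g : M} (hg : s.IsGraph g)
    (h : D ⟶ D') {q : M} : (∃ a d d', qpair a d ∈ g ∧ App h.left d d' ∧ q = qpair a d') ↔
      ∃ (a : A.Elem) (ha : app f a = b), q = qpair a.1 ((s.comp h).toFun a ha).1 := by
  constructor
  · rintro ⟨a, d, d', h1, h2, rfl⟩
    obtain ⟨a, ha, rfl, rfl⟩ := hg.eq_of_mem h1
    exact ⟨a, ha, by rw [h2.unique (App.self _ _)]; rfl⟩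
  · rintro ⟨a, ha, rfl⟩
    exact ⟨_, _, _, hg.mem a ha, App.self _ _, rfl⟩

variable (f) in
theorem exists_piMap (h : D ⟶ D') : ∃ k : piObj f D ⟶ piObj f D', ∀ (p : (piObj f D).Elem)
    (b : B.Elem) (s : FibreSection f D b), s.IsTagged p.1 → (s.comp h).IsTagged (app k p).1 := by
  obtain ⟨k, hk⟩ := exists_hom (piObj f D) (piObj f D')
    (fun p p' => ∃ g b g', p = qpair g (sing b) ∧ p' = qpair g' (sing b) ∧
      ∀ q, q ∈ g' ↔ ∃ a d d', qpair a d ∈ g ∧ App h.left d d' ∧ q = qpair a d') 5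
    (.ex (.ex (t := 4) (.ex (.and (.eq .var4 (.qpair .var2 (.sing .var1)))
      (.and (.eq .var3 (.qpair .var0 (.sing .var1))) (.all (.iff (.mem .var0 .var1)
        (.ex (.ex (.ex (.and (.mem (.qpair .var2 .var1) Tm.var2.weaken.weaken.weaken.weaken)
          (.and (.app h.left .var1 .var0) (.eq .var3 (.qpair .var2 .var0))))))))))))))
    (fun p => by
      obtain ⟨b, s, hs⟩ := mem_piObj.1 p.2
      obtain ⟨g, hg, e⟩ := FibreSection.isTagged_iff.1 hs
      obtain ⟨g', hg'⟩ := SD.exists_set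
        (R := fun q => ∃ a d d', qpair a d ∈ g ∧ App h.left d d' ∧ q = qpair a d') 4
        (.ex (.ex (.ex (.and (.mem (.qpair .var2 .var1) (.const g))
          (.and (.app h.left .var1 .var0) (.eq .var3 (.qpair .var2 .var0)))))))
      refine ⟨⟨qpair g' (sing b.1), mem_piObj.2 ⟨b, s.comp h, FibreSection.isTagged_iff.2
        ⟨g', FibreSection.isGraph_iff.2 fun q => (hg' q).trans (hg.comp h), rfl⟩⟩⟩, ?_⟩
      exact ⟨g, b.1, g', e, rfl, hg'⟩)
    (by
      rintro p q q' ⟨g, b, g₁, e, e₁, h₁⟩ ⟨g', b', g₂, e', e₂, h₂⟩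
      obtain ⟨rfl, eb⟩ := qpair_inj (e.symm.trans e')
      refine Subtype.ext (e₁.trans (Eq.trans ?_ e₂.symm))
      rw [eb, Model.ext g₁ g₂ fun x => (h₁ x).trans (h₂ x).symm])
  refine ⟨k, fun p b s hs => ?_⟩
  obtain ⟨g, b', g', e, e', hg'⟩ := hk p
  obtain ⟨g₁, hg, e₁⟩ := FibreSection.isTagged_iff.1 hs
  obtain ⟨rfl, eb⟩ := qpair_inj (e.symm.trans e₁)
  rw [FibreSection.isTagged_iff]
  exact ⟨g', FibreSection.isGraph_iff.2 fun q => (hg' q).trans (hg.comp h), eb ▸ e'⟩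

variable (f) in
/-- The morphism `⟨s, {b}⟩ ↦ ⟨h ∘ s, {b}⟩`. -/
noncomputable def piMap (h : D ⟶ D') : piObj f D ⟶ piObj f D' := (exists_piMap f h).choose

theorem isTagged_piMap {h : D ⟶ D'} {p : (piObj f D).Elem} {b : B.Elem} {s : FibreSection f D b}
    (hs : s.IsTagged p.1) : (s.comp h).IsTagged (app (piMap f h) p).1 :=
  (exists_piMap f h).choose_spec p b s hs

variable (f) in
/-- The pseudo dependent product along `f`. -/
noncomputable def piFunctor : Over A ⥤ Over ((T M).obj B) where
  obj D := Over.mk (piHom f D)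
  map h := Over.homMk (piMap f h) (hom_ext fun p => by
    obtain ⟨b, s, hs⟩ := mem_piObj.1 p.2
    exact (app_piHom (isTagged_piMap hs)).trans (app_piHom hs).symm)
  map_id D := Over.OverMorphism.ext (hom_ext fun p => Subtype.ext (by
    obtain ⟨b, s, hs⟩ := mem_piObj.1 p.2
    exact (isTagged_piMap (h := 𝟙 D) hs).unique hs))
  map_comp h h' := Over.OverMorphism.ext (hom_ext fun p => Subtype.ext (by
    obtain ⟨b, s, hs⟩ := mem_piObj.1 p.2
    exact (isTagged_piMap (h := h ≫ h') hs).unique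
      (isTagged_piMap (h := h') (isTagged_piMap (h := h) hs))))

theorem isPseudoDependentProduct_piFunctor : IsPseudoDependentProduct f (piFunctor f) where
  mem_obj _ _ := mem_piObj
  app_hom _ _ _ _ hs := app_piHom hs
  app_map _ _ _ _ hs := isTagged_piMap hs

/-! ## The relative adjunction -/

variable {C C' : Over B}

/-- An element of the pullback of `C` along `f`. -/
theorem exists_fibre_elem (c : C.left.Elem) (a : A.Elem)
    (h : app f a = app (B := B) C.hom c) : ∃ x : ((Over.pullback f).obj C).left.Elem,
      app (pullback.fst C.hom f) x = c ∧ app (B := A) ((Over.pullback f).obj C).hom x = a :=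
  exists_pullback_elem C.hom f h.symm

theorem fibre_elem_ext {x y : ((Over.pullback f).obj C).left.Elem}
    (h₁ : app (pullback.fst C.hom f) x = app (pullback.fst C.hom f) y)
    (h₂ : app (B := A) ((Over.pullback f).obj C).hom x =
      app (B := A) ((Over.pullback f).obj C).hom y) : x = y :=
  pullback_elem_ext h₁ h₂

theorem app_fibre_elem (x : ((Over.pullback f).obj C).left.Elem) :
    app f (app (B := A) ((Over.pullback f).obj C).hom x) =
      app (B := B) C.hom (app (pullback.fst C.hom f) x) :=
  congrArg (fun k => app k x) (pullback.condition (f := C.hom) (g := f)).symm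

/-- The section over `f⁻¹{ρ c}` given by a morphism from the pullback of `(C, ρ)`. -/
noncomputable def sectionOf (m : (Over.pullback f).obj C ⟶ D) (c : C.left.Elem) :
    FibreSection f D (app (B := B) C.hom c) where
  toFun a ha := app m.left (exists_fibre_elem c a ha).choose
  proj a ha := by
    have e : app (B := A) D.hom (app m.left (exists_fibre_elem c a ha).choose) =
      app (B := A) (m.left ≫ D.hom) (exists_fibre_elem c a ha).choose := rfl
    rw [e, Over.w m]
    exact (exists_fibre_elem c a ha).choose_spec.2

/-- The choice in `sectionOf` is immaterial, as the two projections determine a point of the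
pullback. -/
theorem sectionOf_toFun (m : (Over.pullback f).obj C ⟶ D) {c : C.left.Elem} {a : A.Elem}
    (ha : app f a = app (B := B) C.hom c) {x : ((Over.pullback f).obj C).left.Elem}
    (h₁ : app (pullback.fst C.hom f) x = c)
    (h₂ : app (B := A) ((Over.pullback f).obj C).hom x = a) :
    (sectionOf m c).toFun a ha = app m.left x :=
  congrArg (app m.left) (fibre_elem_ext ((exists_fibre_elem c a ha).choose_spec.1.trans h₁.symm)
    ((exists_fibre_elem c a ha).choose_spec.2.trans h₂.symm))

end Product

/-! ### The transpose, its bijectivity and its naturality -/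

section Adjunction

variable {M : Type u} [Model M] {A B : NFSet M} {f : A ⟶ B} {D D' : Over A} {C C' : Over B}

/-- This is where `T` is needed: `c` has type 4 and its section type 5, so the assignment is
homogeneous only on `{c}`. -/
theorem exists_transpose (m : (Over.pullback f).obj C ⟶ D) :
    ∃ n : (T M).obj C.left ⟶ piObj f D, ∀ c : C.left.Elem,
      (sectionOf m c).IsTagged (app n (singElem c)).1 := by
  -- `sectionOf` is built by choice outside the model; the left side describes its graph by a
  -- stratified condition.
  have graph : ∀ (c : C.left.Elem) (q : M),
      (∃ a d x, App (pullback.fst C.hom f) x c.1 ∧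
        App (B := A) ((Over.pullback f).obj C).hom x a ∧ App m.left x d ∧ q = qpair a d) ↔
      ∃ (a : A.Elem) (ha : app f a = app (B := B) C.hom c),
        q = qpair a.1 ((sectionOf m c).toFun a ha).1 := by
    intro c q
    constructor
    · rintro ⟨a, d, x, hc, ha, hd, rfl⟩
      obtain ⟨x, a, rfl, rfl, ea⟩ := ha.elems
      have ec := app_iff.1 hc
      have h : app f a = app (B := B) C.hom c := by
        rw [← ea, ← ec]
        exact app_fibre_elem x
      refine ⟨a, h, ?_⟩
      rw [sectionOf_toFun m h ec ea, hd.unique (App.self _ _)]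
    · rintro ⟨a, ha, rfl⟩
      obtain ⟨x, h₁, h₂⟩ := exists_fibre_elem c a ha
      exact ⟨a.1, _, x.1, app_iff.2 h₁, app_iff.2 h₂,
        app_iff.2 (sectionOf_toFun m ha h₁ h₂).symm, rfl⟩
  obtain ⟨n, hn⟩ := exists_hom ((T M).obj C.left) (piObj f D)
    (fun s p => ∃ c, s = sing c ∧ ∃ b, App (B := B) C.hom c b ∧ ∃ g, p = qpair g (sing b) ∧
      ∀ q, q ∈ g ↔ ∃ a d x, App (pullback.fst C.hom f) x c ∧
        App (B := A) ((Over.pullback f).obj C).hom x a ∧ App m.left x d ∧ q = qpair a d) 5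
    (.ex (t := 4) (.and (.eq .var2 (.sing .var0)) (.ex (.and (.app (B := B) C.hom .var1 .var0)
      (.ex (.and (.eq .var3 (.qpair .var0 (.sing .var1))) (.all (.iff (.mem .var0 .var1)
        (.ex (.ex (.ex (.and
          (.app (pullback.fst C.hom f) .var0 Tm.var3.weaken.weaken.weaken)
          (.and (.app (B := A) ((Over.pullback f).obj C).hom .var0 .var2)
            (.and (.app m.left .var0 .var1) (.eq .var3 (.qpair .var2 .var1))))))))))))))))
    (fun s => by
      obtain ⟨c, rfl⟩ := exists_eq_singElem s
      obtain ⟨g, hg⟩ := SD.exists_set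
        (R := fun q => ∃ a d x, App (pullback.fst C.hom f) x c.1 ∧
          App (B := A) ((Over.pullback f).obj C).hom x a ∧ App m.left x d ∧ q = qpair a d) 4
        (.ex (.ex (.ex (.and (.app (pullback.fst C.hom f) .var0 (.const _))
          (.and (.app (B := A) ((Over.pullback f).obj C).hom .var0 .var2)
            (.and (.app m.left .var0 .var1) (.eq .var3 (.qpair .var2 .var1))))))))
      exact ⟨⟨_, mem_piObj.2 ⟨_, sectionOf m c, FibreSection.isTagged_iff.2
        ⟨g, FibreSection.isGraph_iff.2 fun q => (hg q).trans (graph c q), rfl⟩⟩⟩,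
        c.1, rfl, _, App.self _ _, g, rfl, hg⟩)
    (by
      rintro s p p' ⟨c, e, b, hb, g, hp, hg⟩ ⟨c', e', b', hb', g', hp', hg'⟩
      obtain rfl := sing_injective (e.symm.trans e')
      obtain rfl := hb.unique hb'
      rw [Model.ext g g' fun q => (hg q).trans (hg' q).symm] at hp
      exact Subtype.ext (hp.trans hp'.symm))
  refine ⟨n, fun c => ?_⟩
  obtain ⟨c', e, b, hb, g, hp, hg⟩ := hn (singElem c)
  obtain rfl := sing_injective e
  rw [hb.unique (App.self (B := B) C.hom c)] at hp
  exact FibreSection.isTagged_iff.2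
    ⟨g, FibreSection.isGraph_iff.2 fun q => (hg q).trans (graph c q), hp⟩

theorem app_T_map {X Y : NFSet M} (k : X ⟶ Y) (x : X.Elem) :
    app ((T M).map k) (singElem x) = singElem (app k x) := TFun_singElem k x

/-- The transpose of a morphism from the pullback. -/
noncomputable def transpose (m : (Over.pullback f).obj C ⟶ D) :
    (Over.post (X := B) (T M)).obj C ⟶ (piFunctor f).obj D :=
  Over.homMk (exists_transpose m).choose (hom_ext fun s => by
    obtain ⟨c, rfl⟩ := exists_eq_singElem s
    exact (app_piHom ((exists_transpose m).choose_spec c)).trans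
      (app_T_map (Y := B) C.hom c).symm)

theorem isTagged_transpose (m : (Over.pullback f).obj C ⟶ D) (c : C.left.Elem) :
    (sectionOf m c).IsTagged (app (transpose m).left (singElem c)).1 :=
  (exists_transpose m).choose_spec c

theorem eq_of_isTagged {n n' : (Over.post (X := B) (T M)).obj C ⟶ (piFunctor f).obj D}
    (h : ∀ c : C.left.Elem, ∃ (b : B.Elem) (s : FibreSection f D b),
      s.IsTagged (app n.left (singElem c)).1 ∧ s.IsTagged (app n'.left (singElem c)).1) :
    n = n' := by
  refine Over.OverMorphism.ext (hom_ext fun s => ?_)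
  obtain ⟨c, rfl⟩ := exists_eq_singElem s
  obtain ⟨b, s, h₁, h₂⟩ := h c
  exact Subtype.ext (h₁.unique h₂)

/-- The value of `m` at `x` is read off from the section at `{c}`, with `c` and the argument in `A`
the two projections of `x`. -/
theorem transpose_injective :
    Function.Injective (transpose : ((Over.pullback f).obj C ⟶ D) → _) := by
  intro m m' h
  refine Over.OverMorphism.ext (hom_ext fun x => ?_)
  have h₁ := isTagged_transpose m (app (pullback.fst C.hom f) x)
  rw [h] at h₁
  have := (h₁.eq_of_tagged (isTagged_transpose m' _)).2 _ (app_fibre_elem x) (app_fibre_elem x)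
  rwa [sectionOf_toFun m _ rfl rfl, sectionOf_toFun m' _ rfl rfl] at this

theorem transpose_surjective :
    Function.Surjective (transpose : ((Over.pullback f).obj C ⟶ D) → _) := by
  intro n
  -- Since `n` lies over `T B`, the section it gives at `{c}` lives over the fibre of the image of
  -- `c` in `B`.
  have sec : ∀ c : C.left.Elem, ∃ s : FibreSection f D (app (B := B) C.hom c),
      s.IsTagged (app n.left (singElem c)).1 := by
    intro c
    obtain ⟨b, s, hs⟩ := mem_piObj.1 (app n.left (singElem c)).2
    have hb : singElem b = singElem (app (B := B) C.hom c) := by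
      refine (app_piHom hs).symm.trans (Eq.trans ?_ (app_T_map (Y := B) C.hom c))
      exact congrArg (fun k => app k (singElem c)) (Over.w n)
    obtain rfl := singElem_injective hb
    exact ⟨s, hs⟩
  choose s hs using sec
  have graph : ∀ c, ∃ g, (s c).IsGraph g ∧
      (app n.left (singElem c)).1 = qpair g (sing (app (B := B) C.hom c).1) := fun c =>
    FibreSection.isTagged_iff.1 (hs c)
  choose g hg hg' using graph
  -- The chosen `s` and `g` do not occur in the defining relation, which decodes the graph `k` from
  -- the value of `n`; they serve only to verify that it is a function.
  obtain ⟨m, hm⟩ := exists_hom ((Over.pullback f).obj C).left D.left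
    (fun x d => ∃ c a k b, App (pullback.fst C.hom f) x c ∧
      App (B := A) ((Over.pullback f).obj C).hom x a ∧
      App n.left (sing c) (qpair k (sing b)) ∧ qpair a d ∈ k) 4
    (.ex (t := 4) (.ex (t := 4) (.ex (.ex (t := 4) (.and
      (.app (pullback.fst C.hom f) Tm.var3.weaken.weaken .var3)
      (.and (.app (B := A) ((Over.pullback f).obj C).hom Tm.var3.weaken.weaken .var2)
        (.and (.app n.left (.sing .var3) (.qpair .var1 (.sing .var0)))
          (.mem (.qpair .var2 .var4) .var1))))))))
    (fun x => ⟨(s (app (pullback.fst C.hom f) x)).toFun _ (app_fibre_elem x), _, _,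
      g (app (pullback.fst C.hom f) x), _, App.self _ _, App.self _ _,
      ⟨(singElem (app (pullback.fst C.hom f) x)).2, hg' _⟩, (hg _).mem _ _⟩)
    (by
      rintro x d d' ⟨c, a, k, b, hc, ha, hk, hd⟩ ⟨c', a', k', b', hc', ha', hk', hd'⟩
      obtain rfl := hc.unique hc'
      obtain rfl := ha.unique ha'
      obtain rfl := (qpair_inj (hk.unique hk')).1
      obtain rfl := hc.unique (App.self _ x)
      obtain rfl := (qpair_inj (hk.2.symm.trans (hg' (app (pullback.fst C.hom f) x)))).1
      obtain ⟨y, hy, e₁, e₂⟩ := (hg _).eq_of_mem hd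
      obtain ⟨y', hy', e₁', e₂'⟩ := (hg _).eq_of_mem hd'
      obtain rfl := Subtype.ext (e₁.symm.trans e₁')
      exact Subtype.ext (e₂.trans e₂'.symm))
  have hm' : ∀ x, app m x = (s (app (pullback.fst C.hom f) x)).toFun _ (app_fibre_elem x) := by
    intro x
    obtain ⟨c, a, k, b, hc, ha, hk, hd⟩ := hm x
    obtain rfl := hc.unique (App.self _ x)
    obtain rfl := ha.unique (App.self (B := A) _ x)
    obtain rfl := (qpair_inj (hk.2.symm.trans (hg' (app (pullback.fst C.hom f) x)))).1
    obtain ⟨y, hy, e₁, e₂⟩ := (hg _).eq_of_mem hd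
    obtain rfl := Subtype.ext e₁
    exact Subtype.ext e₂
  let m' : (Over.pullback f).obj C ⟶ D := Over.homMk m (hom_ext fun x => by
    refine Eq.trans ?_ ((s (app (pullback.fst C.hom f) x)).proj _ (app_fibre_elem x))
    exact congrArg (app (B := A) D.hom) (hm' x))
  refine ⟨m', eq_of_isTagged fun c => ⟨_, s c, ?_, hs c⟩⟩
  refine (isTagged_transpose m' c).congr rfl fun a ha _ => ?_
  obtain ⟨x, rfl, rfl⟩ := exists_fibre_elem c a ha
  rw [sectionOf_toFun m' ha rfl rfl]
  exact hm' x

/-- At `{c}` both sides carry the section `a ↦ m(k c, a)`. Its base points, the images in `B` of `c`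
and of `k c`, are equal only by `Over.w k`, hence the detour through `FibreSection.IsTagged.congr`.
-/
theorem transpose_naturality_left (k : C' ⟶ C) (m : (Over.pullback f).obj C ⟶ D) :
    transpose ((Over.pullback f).map k ≫ m) =
      (Over.post (X := B) (T M)).map k ≫ transpose m := by
  refine eq_of_isTagged fun c => ⟨_, _, isTagged_transpose _ c, ?_⟩
  have e : app ((Over.post (X := B) (T M)).map k ≫ transpose m).left (singElem c) =
      app (transpose m).left (singElem (app k.left c)) :=
    congrArg (app (transpose m).left) (app_T_map k.left c)
  rw [e]
  refine (isTagged_transpose m (app k.left c)).congr ?_ fun a ha ha' => ?_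
  · exact congrArg (fun l => app l c) (Over.w k)
  · obtain ⟨x, rfl, rfl⟩ := exists_fibre_elem c a ha'
    rw [sectionOf_toFun _ ha' rfl rfl]
    refine sectionOf_toFun m ha (x := app ((Over.pullback f).map k).left x) ?_ ?_
    · exact congrArg (fun l => app l x) (pullback.lift_fst _ _ _)
    · exact congrArg (fun l => app l x) (Over.w ((Over.pullback f).map k))

theorem transpose_naturality_right (m : (Over.pullback f).obj C ⟶ D) (h : D ⟶ D') :
    transpose (m ≫ h) = transpose m ≫ (piFunctor f).map h :=
  eq_of_isTagged fun c => ⟨_, _, isTagged_transpose _ c,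
    isTagged_piMap (h := h) (isTagged_transpose m c)⟩

variable (f) in
/-- The pullback functor is a left adjoint of the pseudo dependent product relative to `T`. -/
noncomputable def pullbackRelativeAdjunction :
    RelativeAdjunction (Over.post (X := B) (T M)) (Over.pullback f) (piFunctor f) where
  homEquiv _ _ := Equiv.ofBijective transpose ⟨transpose_injective, transpose_surjective⟩
  homEquiv_naturality_left k _ m := transpose_naturality_left k m
  homEquiv_naturality_right m h := transpose_naturality_right m h

end Adjunction

end NF

theorem mainTheorem2 (M : Type u) [NF.Model M] :
    ∃ _ : HasPullbacks (NF.NFSet M),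
      ∀ {A B : NF.NFSet M} (f : A ⟶ B),
        ∃ P : Over A ⥤ Over ((NF.T M).obj B),
          NF.IsPseudoDependentProduct f P ∧
          Nonempty (RelativeAdjunction (Over.post (X := B) (NF.T M)) (Over.pullback f) P) :=
  ⟨inferInstance, fun f => ⟨NF.piFunctor f, NF.isPseudoDependentProduct_piFunctor,
    ⟨NF.pullbackRelativeAdjunction f⟩⟩⟩
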